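/- **Theorem 3.5 (Finite initial configurations).** Let $\alpha,\gamma\ge 0$ and let $a(u,v)=\tfrac12\mathbf 1_{\{|u-v|=1\}}$, $u,v\in\mathbb Z$, be the nearest-neighbour random walk kernel. Put $$b(u,(v,w))=\begin{cases} a(u,v)\,\dfrac{a(v,w)\mathbf 1_{\{w\ne u\}}}{\sum_{w'\neq u}a(v,w')}, & a(v,u)<1,\\ 0,&\text{else,}\end{cases}$$ that is, $b(u,(v,w))=\tfrac12$ if $|u-v|=|w-v|=1$ and $u\ne w$, and $b(u,(v,w))=0$ otherwise. Let $X=(X_t)_{t\ge0}$ be the one-dimensional nearest-neighbour cooperative voter model with bias $\alpha$ and cooperation $\gamma$ (cVMBC), i.e. the càdlàg Markov process on $\{0,1\}^{\mathbb Z}$ (type $1$: cooperators, type $0$: defectors) in which the type at $u$ flips at rate $$c(u,X)=\begin{cases}\displaystyle\sum_v a(v,u)X(v)+\gamma\sum_v X(v)\sum_w X(w)\,b(w,(v,u)), & X(u)=0,\\[1ex] \displaystyle(1+\alpha)\sum_v a(v,u)(1-X(v))+\gamma\sum_v(1-X(v))\sum_w X(w)\,b(w,(v,u)), & X(u)=1.\end{cases}$$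 Precisely, with $X^u$ denoting $X$ flipped at $u$ and $(\mathcal L f)(X)=\sum_u c(u,X)\,(f(X^u)-f(X))$, the process solves the martingale problem for $\mathcal L$: the process $f(X_t)-\int_0^t \mathcal L f(X_s)\,ds$ is a martingale for every $f:\{0,1\}^{\mathbb Z}\to\mathbb R$ depending on finitely many coordinates. Assume that the (possibly random) initial configuration $X_0$ almost surely contains only finitely many cooperators or only finitely many defectors, i.e. $X_0=\mathbf 1_A$ or $X_0=1-\mathbf 1_A$ for some finite $A\subseteq\mathbb Z$. Then: 1. (i) The process clusters: $\lim_{t\to\infty}P(X_t(u)=X_t(v))=1$ for all $u,v\in\mathbb Z$. 2. (ii) If $\alpha\ge\gamma$ and $X_0$ almost surely contains finitely many cooperators, the cooperators die out: $P(\lim_{t\to\infty}X_t(u)=0)=1$ for all $u\in\mathbb Z$. 3. (iii) If $\gamma\ge\alpha$ and $X_0$ almost surely contains finitely many defectors, the defectors die out: $P(\lim_{t\to\infty}X_t(u)=1)=1$ for all $u\in\mathbb Z$. -/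

import Mathlib

open MeasureTheory ProbabilityTheory Filter Topology
open scoped NNReal

namespace VMBC

/-- Configurations in `{0,1}^V`: `true` is type 1 (a cooperator), `false` is type 0 (a defector). -/
abbrev Config (V : Type*) := V → Bool

/-- The numerical value `0` or `1` of a type. -/
def val (i : Bool) : ℝ := if i then 1 else 0

/-- The configuration `X^u`, obtained from `X` by changing the type at `u`. -/
def flip {V : Type*} [DecidableEq V] (X : Config V) (u : V) : Config V :=
  Function.update X u (!X u)

/-- The rate `c(u, X)` at which the type at `u` changes in the voter model with bias `α` and
cooperation `γ`; the kernels are `a u v = a(u,v)` and `b u v w = b(u,(v,w))`. -/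
noncomputable def rate {V : Type*} (a : V → V → ℝ) (b : V → V → V → ℝ) (α γ : ℝ)
    (u : V) (X : Config V) : ℝ :=
  if X u then
    (1 + α) * ∑' v, a v u * (1 - val (X v))
      + γ * ∑' v, (1 - val (X v)) * ∑' w, val (X w) * b w v u
  else
    ∑' v, a v u * val (X v) + γ * ∑' v, val (X v) * ∑' w, val (X w) * b w v u

/-- `f` belongs to the domain of the pregenerator: it depends on finitely many coordinates only. -/
def IsCylinder {V : Type*} (f : Config V → ℝ) : Prop :=
  ∃ S : Finset V, DependsOn f (S : Set V)

/-- The pregenerator `(Ω f)(X) = ∑ u, c(u, X) (f(X^u) - f(X))`. -/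
noncomputable def pregenerator {V : Type*} [DecidableEq V] (a : V → V → ℝ) (b : V → V → V → ℝ)
    (α γ : ℝ) (f : Config V → ℝ) (X : Config V) : ℝ :=
  ∑' u, rate a b α γ u X * (f (flip X u) - f X)

/-- The process `X` on the probability space `(Ω, P)` is a voter model with bias and cooperation
with kernels `a`, `b`: its paths are càdlàg (for the product topology on `{0,1}^V`), and it solves
the martingale problem for the pregenerator on the functions of finitely many coordinates, with
respect to some filtration to which it is adapted (equivalently, its own filtration).
When the closure of the pregenerator generates a Feller semigroup, the solutions of this martingale
problem are exactly the càdlàg Markov processes with that generator. -/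
structure IsVMBC {V : Type*} [DecidableEq V] (a : V → V → ℝ) (b : V → V → V → ℝ) (α γ : ℝ)
    {Ω : Type*} [mΩ : MeasurableSpace Ω] (P : Measure Ω) (X : ℝ≥0 → Ω → Config V) : Prop where
  right_continuous : ∀ (ω : Ω) (t : ℝ≥0),
    ContinuousWithinAt (fun s => X s ω) (Set.Ici t) t
  left_limits : ∀ (ω : Ω) (t : ℝ≥0), ∃ l : Config V, Tendsto (fun s => X s ω) (𝓝[<] t) (𝓝 l)
  martingale : ∃ ℱ : Filtration ℝ≥0 mΩ, (∀ t, Measurable[ℱ t] (X t)) ∧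
    ∀ f : Config V → ℝ, IsCylinder f →
      Martingale (fun (t : ℝ≥0) (ω : Ω) =>
        f (X t ω) - ∫ s in (0 : ℝ)..(t : ℝ), pregenerator a b α γ f (X s.toNNReal ω)) ℱ P

/-- The cooperation kernel `b(u,(v,w))` of the cooperative model: the two-step kernel of the
self-avoiding walk with steps from `a`, so that `u` never helps `v` to replace `u`. -/
noncomputable def coopKernel {V : Type*} [DecidableEq V] (a : V → V → ℝ) (u v w : V) : ℝ :=
  if a v u < 1 then
    a u v * ((if w ≠ u then a v w else 0) / ∑' w', if w' ≠ u then a v w' else 0)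
  else 0

/-- `X` is a cooperative voter model with bias and cooperation (cVMBC). -/
def IsCVMBC {V : Type*} [DecidableEq V] (a : V → V → ℝ) (α γ : ℝ)
    {Ω : Type*} [MeasurableSpace Ω] (P : Measure Ω) (X : ℝ≥0 → Ω → Config V) : Prop :=
  IsVMBC a (coopKernel a) α γ P X

/-- The nearest-neighbour random walk kernel on `ℤ`. -/
noncomputable def nnKernel (u v : ℤ) : ℝ := if |u - v| = 1 then 1 / 2 else 0

/-- Type `i` dies out: for every site `u`, almost surely `X_t(u) → 1 - i`. -/
def DiesOut {V : Type*} {Ω : Type*} [MeasurableSpace Ω] (P : Measure Ω)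
    (X : ℝ≥0 → Ω → Config V) (i : Bool) : Prop :=
  ∀ u : V, ∀ᵐ ω ∂P, Tendsto (fun t => X t ω u) atTop (𝓝 (!i))

/-- The process clusters: `P(X_t(u) = X_t(v)) → 1` for all sites `u`, `v`. -/
def Clusters {V : Type*} {Ω : Type*} [MeasurableSpace Ω] (P : Measure Ω)
    (X : ℝ≥0 → Ω → Config V) : Prop :=
  ∀ u v : V, Tendsto (fun t => P {ω | X t ω u = X t ω v}) atTop (𝓝 1)

/-- The configuration contains only finitely many individuals of type `i`. -/
def FinitelyMany {V : Type*} (i : Bool) (x : Config V) : Prop :=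
  {u : V | x u = i}.Finite

end VMBC

/-!
On `ℤ` a site can only flip if it differs from one of its neighbours, so the process is a system of
interfaces (edges with different types at their ends) that move by nearest-neighbour steps and
annihilate in pairs, and no new interfaces appear. The flip rate at a site splits into the pushes
of its two neighbours (`VMBC.rate_nn`), hence the generator applied to a sum of local functions is
a sum over interfaces, and Lyapunov functions can be verified at one interface at a time.

Two energies `V = ∑ u, v u (X u) (X (u + 1))` are used.
* If type `i` is disfavoured (cooperators for `γ ≤ α`, defectors for `α ≤ γ`), the number of
  individuals of type `i` plus the number of interfaces decreases in mean
  (`VMBC.edgeTerm_countEnergy_nonpos`). As the number of individuals of type `i` really changes at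
  each interface, the strictly convex function `exp (-s V)` increases in mean at a rate of at least
  a multiple of `exp (-s V)` as long as there is an interface (`VMBC.isLyapunov_countEnergy`).
* If `α ≠ γ`, lone interfaces are biased walks, hence transient. A large multiple of the number of
  interfaces plus bounded superharmonic functions of their positions decreases in mean, strictly
  so if there is an interface at a given edge (`VMBC.exists_isLyapunov_interface`).

The function `exp (-s V)` is bounded and vanishes where `V = ∞`. It is the limit of functions of
the configuration in a window, and the error from the ends of the window disappears in the limit:
either `V` is infinite, or there are no interfaces near the ends. So Dynkin's formula for cylinder
functions yields the growth of `exp (-s V)` in mean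
(`VMBC.IsLyapunov.integral_expEnergy_le`), without knowing in advance that the process stays
finite. It follows that `exp (-s V)` integrated over the time with an interface has finite mean,
while for small `s` the mean of `exp (-s V)` is close to `1` at all times.

Clustering: the probability of an interface at a given edge is Lipschitz in time, and up to a small
error it is integrable, so it tends to zero (`VMBC.HasDynkin.tendsto_interface`). Without drift one
uses the first energy on each of the two events that one of the types is initially finite.
Extinction: at some time the probability that there are no interfaces and `V` is finite is close
to one, and then type `i` is extinct (`VMBC.HasDynkin.exists_extinct`). This state is absorbing,
because there `exp (-s V)` has reached its maximum `1` (`VMBC.HasDynkin.absorbing`).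
-/

namespace VMBC

/-! ### The flip rates on `ℤ` as sums over interfaces -/

/-- The rate at which an individual of type `x` is pushed to change its type by a neighbour of
type `y`, behind which stands an individual of type `z`. It vanishes unless `x ≠ y`. -/
noncomputable def pushRate (α γ : ℝ) (x y z : Bool) : ℝ :=
  if x = y then 0 else (if x then 1 + α else 1) / 2 + γ / 2 * val z

lemma tsum_nn (u : ℤ) (g : ℤ → ℝ) (h : ∀ v, v ≠ u - 1 → v ≠ u + 1 → g v = 0) :
    ∑' v, g v = g (u - 1) + g (u + 1) := by
  rw [tsum_eq_sum (s := {u - 1, u + 1}), Finset.sum_pair (by lia)]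
  intro v hv
  simp only [Finset.mem_insert, Finset.mem_singleton, not_or] at hv
  exact h v hv.1 hv.2

lemma nnKernel_eq_zero {u v : ℤ} (h : v ≠ u - 1) (h' : v ≠ u + 1) : nnKernel v u = 0 := by
  unfold nnKernel
  rw [if_neg]
  intro h1
  rcases (abs_eq (by norm_num)).1 h1 with h1 | h1 <;> lia

lemma nnKernel_comm (u v : ℤ) : nnKernel u v = nnKernel v u := by
  unfold nnKernel
  rw [abs_sub_comm]

lemma nnKernel_pred (u : ℤ) : nnKernel (u - 1) u = 1 / 2 := by simp [nnKernel]

lemma nnKernel_succ (u : ℤ) : nnKernel (u + 1) u = 1 / 2 := by simp [nnKernel]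

lemma coopKernel_eq_zero_left {w v : ℤ} (u : ℤ) (h : w ≠ v - 1) (h' : w ≠ v + 1) :
    coopKernel nnKernel w v u = 0 := by
  simp [coopKernel, nnKernel_eq_zero h h']

lemma coopKernel_eq_zero_right {v u : ℤ} (w : ℤ) (h : v ≠ u - 1) (h' : v ≠ u + 1) :
    coopKernel nnKernel w v u = 0 := by
  simp [coopKernel, nnKernel_eq_zero h h']

lemma coopKernel_self (v u : ℤ) : coopKernel nnKernel u v u = 0 := by
  simp [coopKernel]

lemma coopKernel_pred_succ (v : ℤ) : coopKernel nnKernel (v - 1) v (v + 1) = 1 / 2 := by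
  unfold coopKernel
  rw [tsum_nn v _ fun w h h' => by rw [nnKernel_comm, nnKernel_eq_zero h h', ite_self]]
  rw [nnKernel_comm v, nnKernel_comm v, nnKernel_pred, nnKernel_succ]
  have h : v + 1 ≠ v - 1 := by lia
  simp only [h, ne_eq, not_false_eq_true, not_true_eq_false, if_true, if_false]
  norm_num

lemma coopKernel_succ_pred (v : ℤ) : coopKernel nnKernel (v + 1) v (v - 1) = 1 / 2 := by
  unfold coopKernel
  rw [tsum_nn v _ fun w h h' => by rw [nnKernel_comm, nnKernel_eq_zero h h', ite_self]]
  rw [nnKernel_comm v, nnKernel_comm v, nnKernel_pred, nnKernel_succ]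
  have h : v - 1 ≠ v + 1 := by lia
  simp only [h, ne_eq, not_false_eq_true, not_true_eq_false, if_true, if_false]
  norm_num

lemma tsum_coopKernel (X : Config ℤ) (u : ℤ) (c : Bool → ℝ) :
    ∑' v, c (X v) * ∑' w, val (X w) * coopKernel nnKernel w v u
      = c (X (u - 1)) * (val (X (u - 2)) / 2) + c (X (u + 1)) * (val (X (u + 2)) / 2) := by
  have key : ∀ v, ∑' w, val (X w) * coopKernel nnKernel w v u
      = val (X (v - 1)) * coopKernel nnKernel (v - 1) v u
        + val (X (v + 1)) * coopKernel nnKernel (v + 1) v u := fun v =>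
    tsum_nn v _ fun w h h' => by rw [coopKernel_eq_zero_left u h h', mul_zero]
  simp only [key]
  rw [tsum_nn u]
  · have h1 := coopKernel_pred_succ (u - 1)
    have h2 := coopKernel_succ_pred (u + 1)
    simp only [sub_add_cancel, add_sub_cancel_right, coopKernel_self] at h1 h2 ⊢
    rw [h1, h2, show u - 1 - 1 = u - 2 by ring, show u + 1 + 1 = u + 2 by ring]
    ring
  · intro v h h'
    simp [coopKernel_eq_zero_right _ h h']

/-- The flip rate is the sum of the pushes from the left and from the right neighbour. -/
lemma rate_nn (α γ : ℝ) (u : ℤ) (X : Config ℤ) :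
    rate nnKernel (coopKernel nnKernel) α γ u X
      = pushRate α γ (X u) (X (u - 1)) (X (u - 2)) + pushRate α γ (X u) (X (u + 1)) (X (u + 2)) := by
  unfold rate
  have hv : ∀ c : Bool → ℝ, ∑' v, nnKernel v u * c (X v)
      = (c (X (u - 1)) + c (X (u + 1))) / 2 := by
    intro c
    rw [tsum_nn u _ fun v h h' => by rw [nnKernel_eq_zero h h', zero_mul], nnKernel_pred,
      nnKernel_succ]
    ring
  rw [hv val, hv fun x => 1 - val x, tsum_coopKernel X u val,
    tsum_coopKernel X u fun x => 1 - val x]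
  unfold pushRate
  generalize val (X (u - 2)) = p
  generalize val (X (u + 2)) = q
  cases X u <;> cases X (u - 1) <;> cases X (u + 1) <;> simp [val] <;> ring

lemma pushRate_self (α γ : ℝ) (x z : Bool) : pushRate α γ x x z = 0 := by simp [pushRate]

lemma pushRate_nonneg {α γ : ℝ} (hα : 0 ≤ α) (hγ : 0 ≤ γ) (x y z : Bool) :
    0 ≤ pushRate α γ x y z := by
  cases x <;> cases y <;> cases z <;> simp [pushRate, val] <;> linarith

lemma pushRate_le {α γ : ℝ} (hα : 0 ≤ α) (hγ : 0 ≤ γ) (x y z : Bool) :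
    pushRate α γ x y z ≤ 1 + α + γ := by
  cases x <;> cases y <;> cases z <;> simp [pushRate, val] <;> linarith

lemma half_le_pushRate {α γ : ℝ} (hα : 0 ≤ α) (hγ : 0 ≤ γ) {x y : Bool} (h : x ≠ y) (z : Bool) :
    1 / 2 ≤ pushRate α γ x y z := by
  cases x <;> cases y <;> cases z <;> simp [pushRate, val] at h ⊢ <;> linarith

/-! ### Functions of finitely many coordinates -/

lemma IsCylinder.exists_comp {V : Type*} {f : Config V → ℝ} (hf : IsCylinder f) :
    ∃ (S : Finset V) (g : (S → Bool) → ℝ), ∀ X, f X = g fun u => X u := by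
  obtain ⟨S, hS⟩ := hf
  obtain ⟨g, hg⟩ := dependsOn_iff_exists_comp.1 hS
  exact ⟨S, g, fun X => by rw [hg]; rfl⟩

lemma IsCylinder.measurable {V : Type*} {f : Config V → ℝ} (hf : IsCylinder f) :
    Measurable f := by
  obtain ⟨S, g, hg⟩ := hf.exists_comp
  rw [funext hg]
  exact (measurable_of_finite g).comp (measurable_pi_lambda _ fun u => measurable_pi_apply _)

lemma IsCylinder.bounded {V : Type*} {f : Config V → ℝ} (hf : IsCylinder f) :
    ∃ C, ∀ X, |f X| ≤ C := by
  obtain ⟨S, g, hg⟩ := hf.exists_comp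
  obtain ⟨C, hC⟩ := (Set.finite_range fun x => |g x|).bddAbove
  exact ⟨C, fun X => by rw [hg]; exact hC ⟨_, rfl⟩⟩

lemma flip_apply_of_ne {V : Type*} [DecidableEq V] (X : Config V) {u v : V} (h : v ≠ u) :
    flip X u v = X v := by simp [flip, h]

lemma flip_apply_self {V : Type*} [DecidableEq V] (X : Config V) (u : V) :
    flip X u u = !X u := by simp [flip]

lemma pregenerator_eq_sum {a : ℤ → ℤ → ℝ} {b : ℤ → ℤ → ℤ → ℝ} {α γ : ℝ} {f : Config ℤ → ℝ}
    {S : Finset ℤ} (hf : DependsOn f (S : Set ℤ)) (X : Config ℤ) :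
    pregenerator a b α γ f X = ∑ u ∈ S, rate a b α γ u X * (f (flip X u) - f X) := by
  unfold pregenerator
  refine tsum_eq_sum fun u hu => ?_
  rw [hf (x := flip X u) (y := X) fun v hv => flip_apply_of_ne X (by rintro rfl; exact hu hv),
    sub_self, mul_zero]

lemma IsCylinder.pregenerator_nn {α γ : ℝ} {f : Config ℤ → ℝ} (hf : IsCylinder f) :
    IsCylinder (pregenerator nnKernel (coopKernel nnKernel) α γ f) := by
  obtain ⟨S, hS⟩ := hf
  refine ⟨S.biUnion fun u => {u - 2, u - 1, u, u + 1, u + 2}, fun X Y h => ?_⟩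
  rw [pregenerator_eq_sum hS, pregenerator_eq_sum hS]
  refine Finset.sum_congr rfl fun u hu => ?_
  have hm : ∀ v, v ∈ ({u - 2, u - 1, u, u + 1, u + 2} : Finset ℤ) → X v = Y v := fun v hv =>
    h v (Finset.mem_coe.2 (Finset.mem_biUnion.2 ⟨u, hu, hv⟩))
  have hSXY : ∀ v ∈ S, X v = Y v := fun v hv =>
    h v (Finset.mem_coe.2 (Finset.mem_biUnion.2 ⟨v, hv, by simp⟩))
  rw [rate_nn, rate_nn, hm u (by simp), hm (u - 1) (by simp), hm (u - 2) (by simp),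
    hm (u + 1) (by simp), hm (u + 2) (by simp), hS (x := X) (y := Y) hSXY,
    hS (x := flip X u) (y := flip Y u)]
  intro v hv
  rcases eq_or_ne v u with rfl | hne
  · rw [flip_apply_self, flip_apply_self, hSXY v hv]
  · rw [flip_apply_of_ne X hne, flip_apply_of_ne Y hne, hSXY v hv]

/-! ### Energies and their change under a flip -/

/-- The energy in the window `[-L, L]`: the sum of the local energies `v u (X u) (X (u + 1))` of
the edges `(u, u + 1)` with `|u| ≤ L`. -/
noncomputable def energy (v : ℤ → Bool → Bool → ℝ) (L : ℕ) (X : Config ℤ) : ℝ :=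
  ∑ u ∈ Finset.Icc (-(L : ℤ)) L, v u (X u) (X (u + 1))

/-- The local energies, put to zero outside the window `[-L, L]`. -/
noncomputable def truncate (v : ℤ → Bool → Bool → ℝ) (L : ℕ) (u : ℤ) : Bool → Bool → ℝ :=
  if u ∈ Finset.Icc (-(L : ℤ)) L then v u else 0

/-- The change of energy when the type `x` at `u` flips and the neighbours have types `a` (left)
and `b` (right). -/
def flipEnergy (v : ℤ → Bool → Bool → ℝ) (u : ℤ) (a x b : Bool) : ℝ :=
  (v (u - 1) a (!x) - v (u - 1) a x) + (v u (!x) b - v u x b)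

/-- The contribution of the edge `(e, e + 1)`, with types `x` and `y` at its ends and types `a`
and `b` at the neighbouring sites, to the sum over all flips of rate times `g` (energy change). -/
noncomputable def edgeTerm (α γ : ℝ) (g : ℝ → ℝ) (v : ℤ → Bool → Bool → ℝ) (e : ℤ)
    (a x y b : Bool) : ℝ :=
  pushRate α γ x y b * g (flipEnergy v e a x y)
    + pushRate α γ y x a * g (flipEnergy v (e + 1) x y b)

lemma energy_flip (v : ℤ → Bool → Bool → ℝ) (L : ℕ) (X : Config ℤ) (u : ℤ) :
    energy v L (flip X u) - energy v L X
      = flipEnergy (truncate v L) u (X (u - 1)) (X u) (X (u + 1)) := by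
  have h : energy v L (flip X u) - energy v L X
      = ∑' w, (truncate v L w (flip X u w) (flip X u (w + 1))
          - truncate v L w (X w) (X (w + 1))) := by
    rw [tsum_eq_sum (s := Finset.Icc (-(L : ℤ)) L)]
    · unfold energy
      rw [← Finset.sum_sub_distrib]
      refine Finset.sum_congr rfl fun w hw => ?_
      simp only [truncate, if_pos hw]
    · intro w hw
      simp only [truncate, if_neg hw, Pi.zero_apply, sub_self]
  rw [h, tsum_eq_sum (s := {u - 1, u}), Finset.sum_pair (by lia)]
  · have h1 : u - 1 ≠ u := by lia
    have h2 : u + 1 ≠ u := by lia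
    rw [sub_add_cancel, flip_apply_self, flip_apply_of_ne X h1, flip_apply_of_ne X h2]
    rfl
  · intro w hw
    simp only [Finset.mem_insert, Finset.mem_singleton, not_or] at hw
    rw [flip_apply_of_ne X hw.2, flip_apply_of_ne X (by lia), sub_self]

lemma dependsOn_energy (v : ℤ → Bool → Bool → ℝ) (L : ℕ) :
    DependsOn (energy v L) (Finset.Icc (-(L : ℤ)) (L + 1) : Finset ℤ) := by
  intro X Y h
  unfold energy
  refine Finset.sum_congr rfl fun u hu => ?_
  rw [Finset.mem_Icc] at hu
  rw [h u (by simp; lia), h (u + 1) (by simp; lia)]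

lemma isCylinder_exp_energy (s : ℝ) (v : ℤ → Bool → Bool → ℝ) (L : ℕ) :
    IsCylinder fun X => Real.exp (-s * energy v L X) :=
  ⟨Finset.Icc (-(L : ℤ)) (L + 1), fun X Y h => by simp only [dependsOn_energy v L h]⟩

lemma flipEnergy_truncate_of_notMem (v : ℤ → Bool → Bool → ℝ) {L : ℕ} {u : ℤ}
    (hu : u ∉ Finset.Icc (-(L : ℤ)) (L + 1)) (a x b : Bool) :
    flipEnergy (truncate v L) u a x b = 0 := by
  rw [Finset.mem_Icc] at hu
  unfold flipEnergy truncate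
  rw [if_neg (by rw [Finset.mem_Icc]; lia), if_neg (by rw [Finset.mem_Icc]; lia)]
  simp

lemma edgeTerm_truncate_of_mem (α γ : ℝ) (g : ℝ → ℝ) (v : ℤ → Bool → Bool → ℝ) {L : ℕ} {e : ℤ}
    (he : e ∈ Finset.Icc (-(L : ℤ) + 1) (L - 1)) :
    edgeTerm α γ g (truncate v L) e = edgeTerm α γ g v e := by
  rw [Finset.mem_Icc] at he
  funext a x y b
  unfold edgeTerm flipEnergy truncate
  rw [if_pos (by rw [Finset.mem_Icc]; lia), if_pos (by rw [Finset.mem_Icc]; lia),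
    if_pos (by rw [Finset.mem_Icc]; lia), if_pos (by rw [Finset.mem_Icc]; lia)]

/-- The pregenerator applied to `exp (-s * energy)`, as a sum over edges. -/
lemma pregenerator_exp_energy (α γ s : ℝ) (v : ℤ → Bool → Bool → ℝ) (L : ℕ) (X : Config ℤ) :
    pregenerator nnKernel (coopKernel nnKernel) α γ (fun X => Real.exp (-s * energy v L X)) X
      = Real.exp (-s * energy v L X) * ∑ e ∈ Finset.Icc (-(L : ℤ) - 1) (L + 1),
          edgeTerm α γ (fun z => Real.exp (-s * z) - 1) (truncate v L) e
            (X (e - 1)) (X e) (X (e + 1)) (X (e + 2)) := by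
  set g : ℝ → ℝ := fun z => Real.exp (-s * z) - 1 with hg
  set d : ℤ → ℝ := fun u =>
    g (flipEnergy (truncate v L) u (X (u - 1)) (X u) (X (u + 1))) with hd
  have hd0 : ∀ u, u ∉ Finset.Icc (-(L : ℤ)) (L + 1) → d u = 0 := fun u hu => by
    simp only [hd, flipEnergy_truncate_of_notMem v hu, hg]
    simp
  rw [pregenerator_eq_sum (S := Finset.Icc (-(L : ℤ)) (L + 1))
    fun X Y h => by simp only [dependsOn_energy v L h]]
  have h1 : ∀ u, rate nnKernel (coopKernel nnKernel) α γ u X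
      * (Real.exp (-s * energy v L (flip X u)) - Real.exp (-s * energy v L X))
      = Real.exp (-s * energy v L X)
        * (pushRate α γ (X u) (X (u + 1)) (X (u + 2)) * d u)
        + Real.exp (-s * energy v L X)
        * (pushRate α γ (X u) (X (u - 1)) (X (u - 2)) * d u) := fun u => by
    have h2 : Real.exp (-s * energy v L (flip X u))
        = Real.exp (-s * energy v L X) * (d u + 1) := by
      simp only [hd, hg, sub_add_cancel]
      rw [← Real.exp_add, ← energy_flip]
      congr 1
      ring
    rw [h2, rate_nn]
    ring
  simp only [h1]
  rw [Finset.sum_add_distrib, ← Finset.mul_sum, ← Finset.mul_sum, ← mul_add]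
  congr 1
  have hR : ∑ u ∈ Finset.Icc (-(L : ℤ)) (L + 1),
      pushRate α γ (X u) (X (u + 1)) (X (u + 2)) * d u
      = ∑ e ∈ Finset.Icc (-(L : ℤ) - 1) (L + 1),
        pushRate α γ (X e) (X (e + 1)) (X (e + 2)) * d e := by
    refine Finset.sum_subset (Finset.Icc_subset_Icc (by lia) le_rfl) fun u _ hu => ?_
    rw [hd0 u hu, mul_zero]
  have hL : ∑ u ∈ Finset.Icc (-(L : ℤ)) (L + 1),
      pushRate α γ (X u) (X (u - 1)) (X (u - 2)) * d u
      = ∑ e ∈ Finset.Icc (-(L : ℤ) - 1) (L + 1),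
        pushRate α γ (X (e + 1)) (X e) (X (e - 1)) * d (e + 1) := by
    rw [Finset.sum_subset (Finset.Icc_subset_Icc le_rfl (by lia : (L : ℤ) + 1 ≤ L + 2))
      fun u _ hu => by rw [hd0 u hu, mul_zero]]
    have himg : Finset.Icc (-(L : ℤ)) (L + 2)
        = (Finset.Icc (-(L : ℤ) - 1) (L + 1)).map (addRightEmbedding 1) := by
      rw [Finset.map_add_right_Icc]
      congr 1; ring
    rw [himg, Finset.sum_map]
    refine Finset.sum_congr rfl fun e _ => ?_
    simp only [addRightEmbedding_apply]
    rw [add_sub_cancel_right, show e + 1 - 2 = e - 1 by ring]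
  rw [hR, hL, ← Finset.sum_add_distrib]
  refine Finset.sum_congr rfl fun e _ => ?_
  simp only [edgeTerm, hd]
  rw [add_sub_cancel_right, show e + 1 + 1 = e + 2 by ring]

/-! ### Exponentials of the total energy -/

/-- `exp (-s V)`, where `V ∈ [0, ∞]` is the total energy; it vanishes where `V = ∞`. -/
noncomputable def expEnergy (s : ℝ) (v : ℤ → Bool → Bool → ℝ) (X : Config ℤ) : ℝ :=
  ⨅ L : ℕ, Real.exp (-s * energy v L X)

/-- The indicator of the event that an edge of `Q` is an interface. -/
noncomputable def hasInterface (Q : Set ℤ) (X : Config ℤ) : ℝ :=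
  open Classical in if ∃ e ∈ Q, X e ≠ X (e + 1) then 1 else 0

lemma hasInterface_nonneg (Q : Set ℤ) (X : Config ℤ) : 0 ≤ hasInterface Q X := by
  unfold hasInterface
  split_ifs <;> norm_num

lemma hasInterface_le_one (Q : Set ℤ) (X : Config ℤ) : hasInterface Q X ≤ 1 := by
  unfold hasInterface
  split_ifs <;> norm_num

lemma measurableSet_interface (e : ℤ) : MeasurableSet {X : Config ℤ | X e ≠ X (e + 1)} :=
  (measurableSet_eq_fun (measurable_pi_apply e) (measurable_pi_apply (e + 1))).compl

lemma measurableSet_hasInterface (Q : Set ℤ) :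
    MeasurableSet {X : Config ℤ | ∃ e ∈ Q, X e ≠ X (e + 1)} := by
  have : {X : Config ℤ | ∃ e ∈ Q, X e ≠ X (e + 1)} = ⋃ e ∈ Q, {X | X e ≠ X (e + 1)} := by
    ext X; simp
  rw [this]
  exact MeasurableSet.biUnion Q.to_countable fun e _ => measurableSet_interface e

lemma measurable_hasInterface (Q : Set ℤ) : Measurable (hasInterface Q) :=
  Measurable.ite (measurableSet_hasInterface Q) measurable_const measurable_const

section

variable {s : ℝ} {v : ℤ → Bool → Bool → ℝ}

lemma energy_mono (hv : ∀ u x y, 0 ≤ v u x y) (X : Config ℤ) : Monotone fun L => energy v L X := by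
  intro L M h
  exact Finset.sum_le_sum_of_subset_of_nonneg (Finset.Icc_subset_Icc (by lia) (by lia))
    fun u _ _ => hv u _ _

lemma energy_nonneg (hv : ∀ u x y, 0 ≤ v u x y) (L : ℕ) (X : Config ℤ) : 0 ≤ energy v L X :=
  Finset.sum_nonneg fun u _ => hv u _ _

lemma bddBelow_exp_energy (s : ℝ) (v : ℤ → Bool → Bool → ℝ) (X : Config ℤ) :
    BddBelow (Set.range fun L : ℕ => Real.exp (-s * energy v L X)) :=
  ⟨0, by rintro _ ⟨L, rfl⟩; exact (Real.exp_pos _).le⟩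

lemma tendsto_exp_energy (hs : 0 ≤ s) (hv : ∀ u x y, 0 ≤ v u x y) (X : Config ℤ) :
    Tendsto (fun L : ℕ => Real.exp (-s * energy v L X)) atTop (𝓝 (expEnergy s v X)) := by
  refine tendsto_atTop_ciInf (fun L M h => ?_) (bddBelow_exp_energy s v X)
  have := mul_le_mul_of_nonneg_left (energy_mono hv X h) hs
  exact Real.exp_le_exp.2 (by simp only at this; linarith)

lemma expEnergy_nonneg (s : ℝ) (v : ℤ → Bool → Bool → ℝ) (X : Config ℤ) : 0 ≤ expEnergy s v X :=
  le_ciInf fun _ => (Real.exp_pos _).le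

lemma expEnergy_le (s : ℝ) (v : ℤ → Bool → Bool → ℝ) (L : ℕ) (X : Config ℤ) :
    expEnergy s v X ≤ Real.exp (-s * energy v L X) :=
  ciInf_le (bddBelow_exp_energy s v X) L

lemma exp_energy_le_one (hs : 0 ≤ s) (hv : ∀ u x y, 0 ≤ v u x y) (L : ℕ) (X : Config ℤ) :
    Real.exp (-s * energy v L X) ≤ 1 := by
  rw [Real.exp_le_one_iff]
  have := mul_nonneg hs (energy_nonneg hv L X)
  linarith

lemma expEnergy_le_one (hs : 0 ≤ s) (hv : ∀ u x y, 0 ≤ v u x y) (X : Config ℤ) :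
    expEnergy s v X ≤ 1 :=
  (expEnergy_le s v 0 X).trans (exp_energy_le_one hs hv 0 X)

lemma measurable_expEnergy (s : ℝ) (v : ℤ → Bool → Bool → ℝ) : Measurable (expEnergy s v) :=
  Measurable.iInf fun L => (isCylinder_exp_energy s v L).measurable

/-- Where `exp (-s V)` does not vanish, only finitely many edges carry energy at least `1`. -/
lemma finite_of_expEnergy_pos (hs : 0 < s) (hv : ∀ u x y, 0 ≤ v u x y) {X : Config ℤ}
    (h : 0 < expEnergy s v X) : {u : ℤ | 1 ≤ v u (X u) (X (u + 1))}.Finite := by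
  by_contra hinf
  obtain ⟨n, hn⟩ := exists_nat_gt (-Real.log (expEnergy s v X) / s)
  obtain ⟨T, hT, hcard⟩ := Set.Infinite.exists_subset_card_eq hinf n
  obtain ⟨L, hL⟩ : ∃ L : ℕ, T ⊆ Finset.Icc (-(L : ℤ)) L := by
    refine ⟨T.sup Int.natAbs, fun u hu => ?_⟩
    have := Finset.le_sup (f := Int.natAbs) hu
    rw [Finset.mem_Icc]
    lia
  have h1 : (n : ℝ) ≤ energy v L X := by
    calc (n : ℝ) = ∑ u ∈ T, (1 : ℝ) := by simp [hcard]
      _ ≤ ∑ u ∈ T, v u (X u) (X (u + 1)) := Finset.sum_le_sum fun u hu => hT hu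
      _ ≤ energy v L X := Finset.sum_le_sum_of_subset_of_nonneg hL fun u _ _ => hv u _ _
  have h2 := Real.log_le_log h (expEnergy_le s v L X)
  rw [Real.log_exp] at h2
  rw [div_lt_iff₀ hs] at hn
  nlinarith

end

/-! ### Lyapunov energies -/

/-- The local energies `v` are such that `exp (-s V)` increases in mean along the process: each
edge contributes a nonnegative amount, and each interface in `Q` at least `κ`. Moreover each
interface costs energy at least `1`, so that `V` controls the number of interfaces. -/
structure IsLyapunov (α γ : ℝ) (v : ℤ → Bool → Bool → ℝ) (Q : Set ℤ) (s κ : ℝ) : Prop where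
  nonneg : ∀ u x y, 0 ≤ v u x y
  one_le : ∀ u x y, x ≠ y → 1 ≤ v u x y
  pos : 0 < s
  gain_pos : 0 < κ
  edge_nonneg : ∀ e a x y b, x ≠ y → 0 ≤ edgeTerm α γ (fun z => Real.exp (-s * z) - 1) v e a x y b
  edge_gain : ∀ e ∈ Q, ∀ a x y b, x ≠ y →
    κ ≤ edgeTerm α γ (fun z => Real.exp (-s * z) - 1) v e a x y b

lemma edgeTerm_self (α γ : ℝ) (g : ℝ → ℝ) (v : ℤ → Bool → Bool → ℝ) (e : ℤ) (a x b : Bool) :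
    edgeTerm α γ g v e a x x b = 0 := by simp [edgeTerm, pushRate_self]

lemma hasInterface_singleton (e : ℤ) (X : Config ℤ) :
    hasInterface {e} X = if X e ≠ X (e + 1) then 1 else 0 := by simp [hasInterface]

lemma neg_le_edgeTerm {α γ : ℝ} (hα : 0 ≤ α) (hγ : 0 ≤ γ) (s : ℝ) (v : ℤ → Bool → Bool → ℝ) (e : ℤ)
    (X : Config ℤ) :
    -(2 * (1 + α + γ) * hasInterface {e} X) ≤ edgeTerm α γ (fun z => Real.exp (-s * z) - 1) v e
      (X (e - 1)) (X e) (X (e + 1)) (X (e + 2)) := by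
  rw [hasInterface_singleton]
  by_cases h : X e = X (e + 1)
  · rw [← h, edgeTerm_self]; simp
  · rw [if_pos h]
    have key : ∀ p z : ℝ, 0 ≤ p → p ≤ 1 + α + γ → -(1 + α + γ) ≤ p * (Real.exp (-s * z) - 1) := by
      intro p z hp hp'
      have := mul_nonneg hp (Real.exp_pos (-s * z)).le
      linarith
    unfold edgeTerm
    have h1 := key _ (flipEnergy v e (X (e - 1)) (X e) (X (e + 1)))
      (pushRate_nonneg hα hγ (X e) (X (e + 1)) (X (e + 2))) (pushRate_le hα hγ _ _ _)
    have h2 := key _ (flipEnergy v (e + 1) (X e) (X (e + 1)) (X (e + 2)))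
      (pushRate_nonneg hα hγ (X (e + 1)) (X e) (X (e - 1))) (pushRate_le hα hγ _ _ _)
    linarith

/-- The number of interfaces at the four edges at which the energy of a window of size `L` is not
the full energy. -/
noncomputable def boundaryCount (L : ℕ) (X : Config ℤ) : ℝ :=
  hasInterface {-(L : ℤ) - 1} X + hasInterface {-(L : ℤ)} X + hasInterface {(L : ℤ)} X
    + hasInterface {(L : ℤ) + 1} X

lemma boundaryCount_nonneg (L : ℕ) (X : Config ℤ) : 0 ≤ boundaryCount L X := by
  unfold boundaryCount
  linarith [hasInterface_nonneg {-(L : ℤ) - 1} X, hasInterface_nonneg {-(L : ℤ)} X,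
    hasInterface_nonneg {(L : ℤ)} X, hasInterface_nonneg {(L : ℤ) + 1} X]

lemma boundaryCount_le (L : ℕ) (X : Config ℤ) : boundaryCount L X ≤ 4 := by
  unfold boundaryCount
  linarith [hasInterface_le_one {-(L : ℤ) - 1} X, hasInterface_le_one {-(L : ℤ)} X,
    hasInterface_le_one {(L : ℤ)} X, hasInterface_le_one {(L : ℤ) + 1} X]

lemma measurable_boundaryCount (L : ℕ) : Measurable (boundaryCount L) := by
  unfold boundaryCount
  exact (((measurable_hasInterface _).add (measurable_hasInterface _)).add
    (measurable_hasInterface _)).add (measurable_hasInterface _)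

/-- The pregenerator applied to the exponential of a windowed Lyapunov energy is nonnegative up to
an error from the ends of the window. -/
lemma IsLyapunov.le_pregenerator {α γ : ℝ} (hα : 0 ≤ α) (hγ : 0 ≤ γ)
    {v : ℤ → Bool → Bool → ℝ} {Q : Set ℤ} {s κ : ℝ} (h : IsLyapunov α γ v Q s κ) {L : ℕ}
    (hL : 1 ≤ L) (X : Config ℤ) :
    Real.exp (-s * energy v L X)
        * (κ * hasInterface (Q ∩ Set.Icc (-(L : ℤ) + 1) (L - 1)) X
          - 2 * (1 + α + γ) * boundaryCount L X)
      ≤ pregenerator nnKernel (coopKernel nnKernel) α γ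
          (fun X => Real.exp (-s * energy v L X)) X := by
  rw [pregenerator_exp_energy]
  refine mul_le_mul_of_nonneg_left ?_ (Real.exp_pos _).le
  set E : ℤ → ℝ := fun e => edgeTerm α γ (fun z => Real.exp (-s * z) - 1) (truncate v L) e
            (X (e - 1)) (X e) (X (e + 1)) (X (e + 2)) with hE
  have hsplit : ∑ e ∈ Finset.Icc (-(L : ℤ) - 1) (L + 1), E e
      = E (-(L : ℤ) - 1) + (E (-(L : ℤ)) + (E L + (E (L + 1)
        + ∑ e ∈ Finset.Icc (-(L : ℤ) + 1) (L - 1), E e))) := by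
    have : Finset.Icc (-(L : ℤ) - 1) (L + 1) = insert (-(L : ℤ) - 1) (insert (-(L : ℤ))
        (insert (L : ℤ) (insert ((L : ℤ) + 1) (Finset.Icc (-(L : ℤ) + 1) (L - 1))))) := by
      ext e
      simp only [Finset.mem_Icc, Finset.mem_insert]
      lia
    rw [this, Finset.sum_insert, Finset.sum_insert, Finset.sum_insert, Finset.sum_insert] <;>
      simp only [Finset.mem_Icc, Finset.mem_insert] <;> lia
  have hb : ∀ e, -(2 * (1 + α + γ) * hasInterface {e} X) ≤ E e := fun e =>
    neg_le_edgeTerm hα hγ s _ e X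
  have hint : ∀ e ∈ Finset.Icc (-(L : ℤ) + 1) (L - 1), 0 ≤ E e := fun e he => by
    simp only [hE, edgeTerm_truncate_of_mem _ _ _ _ he]
    by_cases hx : X e = X (e + 1)
    · rw [← hx, edgeTerm_self]
    · exact h.edge_nonneg _ _ _ _ _ hx
  have hgain : κ * hasInterface (Q ∩ Set.Icc (-(L : ℤ) + 1) (L - 1)) X
      ≤ ∑ e ∈ Finset.Icc (-(L : ℤ) + 1) (L - 1), E e := by
    unfold hasInterface
    split_ifs with hQ
    · obtain ⟨e, ⟨heQ, he⟩, hx⟩ := hQ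
      rw [← Finset.coe_Icc, Finset.mem_coe] at he
      refine le_trans ?_ (Finset.single_le_sum hint he)
      simp only [hE, edgeTerm_truncate_of_mem _ _ _ _ he, mul_one]
      exact h.edge_gain e heQ _ _ _ _ hx
    · rw [mul_zero]
      exact Finset.sum_nonneg hint
  rw [hsplit]
  unfold boundaryCount
  linarith [hb (-(L : ℤ) - 1), hb (-(L : ℤ)), hb L, hb (L + 1)]

lemma tendsto_hasInterface_inter (Q : Set ℤ) (X : Config ℤ) :
    Tendsto (fun L : ℕ => hasInterface (Q ∩ Set.Icc (-(L : ℤ) + 1) (L - 1)) X) atTop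
      (𝓝 (hasInterface Q X)) := by
  refine tendsto_const_nhds.congr' ?_
  by_cases hQ : ∃ e ∈ Q, X e ≠ X (e + 1)
  · obtain ⟨e, he, hx⟩ := hQ
    filter_upwards [eventually_ge_atTop (e.natAbs + 1)] with L hL
    unfold hasInterface
    rw [if_pos ⟨e, he, hx⟩, if_pos ⟨e, ⟨he, by rw [Set.mem_Icc]; lia⟩, hx⟩]
  · refine Eventually.of_forall fun L => ?_
    unfold hasInterface
    rw [if_neg hQ]
    exact (if_neg fun ⟨e, he, hx⟩ => hQ ⟨e, he.1, hx⟩).symm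

/-- The error from the ends of the window disappears in the limit: either the energy is infinite,
or there are only finitely many interfaces. -/
lemma IsLyapunov.tendsto_boundary {α γ : ℝ} {v : ℤ → Bool → Bool → ℝ} {Q : Set ℤ} {s κ : ℝ}
    (h : IsLyapunov α γ v Q s κ) (X : Config ℤ) :
    Tendsto (fun L : ℕ => Real.exp (-s * energy v L X) * boundaryCount L X) atTop (𝓝 0) := by
  rcases (expEnergy_nonneg s v X).eq_or_lt with h0 | hpos
  · have := (tendsto_exp_energy h.pos.le h.nonneg X).mul_const 4
    rw [← h0, zero_mul] at this
    exact squeeze_zero (fun L => mul_nonneg (Real.exp_pos _).le (boundaryCount_nonneg L X))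
      (fun L => mul_le_mul_of_nonneg_left (boundaryCount_le L X) (Real.exp_pos _).le) this
  · have hfin := (finite_of_expEnergy_pos h.pos h.nonneg hpos).subset
      (fun u (hu : X u ≠ X (u + 1)) => h.one_le u _ _ hu)
    obtain ⟨M, hM⟩ : ∃ M : ℕ, ∀ u, X u ≠ X (u + 1) → u.natAbs ≤ M :=
      ⟨hfin.toFinset.sup Int.natAbs, fun u hu => Finset.le_sup (f := Int.natAbs) (hfin.mem_toFinset.2 hu)⟩
    refine tendsto_const_nhds.congr' ?_
    filter_upwards [eventually_gt_atTop M] with L hL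
    have key : ∀ e : ℤ, M < e.natAbs → hasInterface {e} X = 0 := fun e he => by
      rw [hasInterface_singleton, if_neg fun hx => absurd (hM e hx) (by lia)]
    unfold boundaryCount
    rw [key _ (by lia), key _ (by lia), key _ (by lia), key _ (by lia)]
    simp

/-- **Mean growth of `exp (-s V)`.** Let `μ₀` and `μ₁` be the laws of the process at two times and
`ν` its occupation measure in between, so that Dynkin's formula holds for cylinder functions. Then
`exp (-s V)` grows in mean by at least `κ` times the mean of `exp (-s V)` over the time during
which there is an interface in `Q`. -/
theorem IsLyapunov.integral_expEnergy_le {α γ : ℝ} (hα : 0 ≤ α) (hγ : 0 ≤ γ)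
    {v : ℤ → Bool → Bool → ℝ} {Q : Set ℤ} {s κ : ℝ} (h : IsLyapunov α γ v Q s κ)
    {μ₀ μ₁ ν : Measure (Config ℤ)} [IsFiniteMeasure μ₀] [IsFiniteMeasure μ₁] [IsFiniteMeasure ν]
    (hdyn : ∀ f, IsCylinder f →
      ∫ X, f X ∂μ₁ = ∫ X, f X ∂μ₀ + ∫ X, pregenerator nnKernel (coopKernel nnKernel) α γ f X ∂ν) :
    ∫ X, expEnergy s v X ∂μ₀ + κ * ∫ X, expEnergy s v X * hasInterface Q X ∂ν
      ≤ ∫ X, expEnergy s v X ∂μ₁ := by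
  have hlim : ∀ (μ : Measure (Config ℤ)) [IsFiniteMeasure μ],
      Tendsto (fun L : ℕ => ∫ X, Real.exp (-s * energy v L X) ∂μ) atTop
        (𝓝 (∫ X, expEnergy s v X ∂μ)) := by
    intro μ _
    refine tendsto_integral_of_dominated_convergence (fun _ => 1)
      (fun L => (isCylinder_exp_energy s v L).measurable.aestronglyMeasurable)
      (integrable_const _) (fun L => ae_of_all _ fun X => ?_)
      (ae_of_all _ fun X => tendsto_exp_energy h.pos.le h.nonneg X)
    rw [Real.norm_of_nonneg (Real.exp_pos _).le]
    exact exp_energy_le_one h.pos.le h.nonneg L X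
  set k : ℕ → Config ℤ → ℝ := fun L X => Real.exp (-s * energy v L X)
        * (κ * hasInterface (Q ∩ Set.Icc (-(L : ℤ) + 1) (L - 1)) X
          - 2 * (1 + α + γ) * boundaryCount L X) with hk
  have hkm : ∀ L, Measurable (k L) := fun L =>
    (isCylinder_exp_energy s v L).measurable.mul (((measurable_hasInterface _).const_mul _).sub
      ((measurable_boundaryCount L).const_mul _))
  have hkb : ∀ L X, ‖k L X‖ ≤ κ + 2 * (1 + α + γ) * 4 := fun L X => by
    simp only [hk]
    rw [norm_mul, Real.norm_of_nonneg (Real.exp_pos _).le]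
    have hC : 0 ≤ 2 * (1 + α + γ) := by linarith
    refine (mul_le_of_le_one_left (norm_nonneg _)
      (exp_energy_le_one h.pos.le h.nonneg L X)).trans ?_
    refine (norm_sub_le _ _).trans (add_le_add ?_ ?_)
    · rw [Real.norm_of_nonneg (mul_nonneg h.gain_pos.le (hasInterface_nonneg _ _))]
      exact mul_le_of_le_one_right h.gain_pos.le (hasInterface_le_one _ _)
    · rw [Real.norm_of_nonneg (mul_nonneg hC (boundaryCount_nonneg _ _))]
      exact mul_le_mul_of_nonneg_left (boundaryCount_le _ _) hC
  have hklim : Tendsto (fun L => ∫ X, k L X ∂ν) atTop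
      (𝓝 (∫ X, κ * (expEnergy s v X * hasInterface Q X) ∂ν)) := by
    refine tendsto_integral_of_dominated_convergence (fun _ => κ + 2 * (1 + α + γ) * 4)
      (fun L => (hkm L).aestronglyMeasurable) (integrable_const _)
      (fun L => ae_of_all _ (hkb L)) (ae_of_all _ fun X => ?_)
    have h1 := ((tendsto_exp_energy h.pos.le h.nonneg X).mul
      (tendsto_hasInterface_inter Q X)).const_mul κ
    have h2 := (h.tendsto_boundary X).const_mul (2 * (1 + α + γ))
    have h3 := h1.sub h2
    rw [mul_zero, sub_zero] at h3
    refine h3.congr fun L => ?_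
    simp only [hk]
    ring
  rw [← integral_const_mul]
  refine le_of_tendsto_of_tendsto ((hlim μ₀).add hklim) (hlim μ₁) ?_
  filter_upwards [eventually_ge_atTop 1] with L hL
  rw [hdyn _ (isCylinder_exp_energy s v L)]
  have hcyl := (isCylinder_exp_energy s v L).pregenerator_nn (α := α) (γ := γ)
  obtain ⟨C, hC⟩ := hcyl.bounded
  exact add_le_add le_rfl (integral_mono
    (Integrable.of_bound (hkm L).aestronglyMeasurable _ (ae_of_all _ (hkb L)))
    (Integrable.of_bound hcyl.measurable.aestronglyMeasurable C (ae_of_all _ hC))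
    (h.le_pregenerator hα hγ hL))

/-! ### Two families of Lyapunov energies -/

lemma bool_eq_of_ne {x y z : Bool} (h : x ≠ z) (h' : y ≠ z) : x = y :=
  (Bool.eq_not_of_ne h).trans (Bool.eq_not_of_ne h').symm

lemma neg_mul_edgeTerm_le {α γ : ℝ} (hα : 0 ≤ α) (hγ : 0 ≤ γ) (s : ℝ) (v : ℤ → Bool → Bool → ℝ)
    (e : ℤ) (a x y b : Bool) :
    -s * edgeTerm α γ id v e a x y b
      ≤ edgeTerm α γ (fun z => Real.exp (-s * z) - 1) v e a x y b := by
  have key : ∀ p z : ℝ, 0 ≤ p → p * (-s * z) ≤ p * (Real.exp (-s * z) - 1) := fun p z hp =>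
    mul_le_mul_of_nonneg_left (by linarith [Real.add_one_le_exp (-s * z)]) hp
  have h1 := key _ (flipEnergy v e a x y) (pushRate_nonneg hα hγ x y b)
  have h2 := key _ (flipEnergy v (e + 1) x y b) (pushRate_nonneg hα hγ y x a)
  simp only [edgeTerm, id]
  linarith

/-- The local energies whose sum is the number of individuals of type `i` plus the number of
interfaces. -/
noncomputable def countEnergy (i : Bool) (_ : ℤ) (x y : Bool) : ℝ :=
  (if x = i then 1 else 0) + if x = y then 0 else 1

/-- The number of individuals of type `i` plus the number of interfaces decreases in mean if type
`i` is the disfavoured one. The isolated individuals, near which the number of individuals of type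
`i` alone may have a positive drift, are compensated by the interfaces that vanish with them. -/
lemma edgeTerm_countEnergy_nonpos {α γ : ℝ} (hα : 0 ≤ α) (hγ : 0 ≤ γ) {i : Bool}
    (hi : if i then γ ≤ α else α ≤ γ) (e : ℤ) (a x y b : Bool) :
    edgeTerm α γ id (countEnergy i) e a x y b ≤ 0 := by
  cases i <;> cases a <;> cases x <;> cases y <;> cases b <;>
    simp [edgeTerm, flipEnergy, countEnergy, pushRate, val] at hi ⊢ <;> linarith

lemma flipEnergy_countEnergy_le (i : Bool) (u : ℤ) {a b : Bool} (h : a ≠ i ∨ b ≠ i) :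
    flipEnergy (countEnergy i) u a i b ≤ -1 := by
  cases i <;> cases a <;> cases b <;> simp [flipEnergy, countEnergy] at h ⊢

lemma isLyapunov_countEnergy {α γ : ℝ} (hα : 0 ≤ α) (hγ : 0 ≤ γ) {i : Bool}
    (hi : if i then γ ≤ α else α ≤ γ) {s : ℝ} (hs : 0 < s) :
    IsLyapunov α γ (countEnergy i) Set.univ s (s ^ 2 / 4) := by
  have gain : ∀ e a x y b, x ≠ y → s ^ 2 / 4 ≤
      edgeTerm α γ (fun z => Real.exp (-s * z) - 1) (countEnergy i) e a x y b := by
    intro e a x y b hxy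
    have hT := mul_nonneg hs.le (neg_nonneg.2 (edgeTerm_countEnergy_nonpos hα hγ hi e a x y b))
    simp only [edgeTerm, id] at hT ⊢
    have h1 := half_le_pushRate hα hγ hxy b
    have h2 := half_le_pushRate hα hγ hxy.symm a
    -- The flip that removes an individual of type `i` gains from the strict convexity of `exp`.
    have strict : ∀ p z : ℝ, 1 / 2 ≤ p → z ≤ -1 →
        p * (-s * z) + s ^ 2 / 4 ≤ p * (Real.exp (-s * z) - 1) := fun p z hp hz => by
      have hsz : s ≤ -s * z := by nlinarith
      have hq := Real.quadratic_le_exp_of_nonneg (hs.le.trans hsz)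
      have hsq : s ^ 2 ≤ (-s * z) ^ 2 := pow_le_pow_left₀ hs.le hsz 2
      nlinarith [sq_nonneg s]
    have weak : ∀ p z : ℝ, 1 / 2 ≤ p → p * (-s * z) ≤ p * (Real.exp (-s * z) - 1) :=
      fun p z hp => mul_le_mul_of_nonneg_left (by linarith [Real.add_one_le_exp (-s * z)])
        (by linarith)
    by_cases hx : x = i
    · subst hx
      have k1 := strict _ _ h1 (flipEnergy_countEnergy_le x e (a := a) (Or.inr hxy.symm))
      have k2 := weak _ (flipEnergy (countEnergy x) (e + 1) x y b) h2
      linarith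
    · have hy : y = i := bool_eq_of_ne hxy.symm (Ne.symm hx)
      subst hy
      have k1 := weak _ (flipEnergy (countEnergy y) e a x y) h1
      have k2 := strict _ _ h2 (flipEnergy_countEnergy_le y (e + 1) (b := b) (Or.inl hxy))
      linarith
  refine ⟨fun u x y => ?_, fun u x y hxy => ?_, hs, by positivity, fun e a x y b hxy => ?_,
    fun e _ => gain e⟩
  · unfold countEnergy
    split_ifs <;> norm_num
  · unfold countEnergy
    rw [if_neg hxy]
    split_ifs <;> norm_num
  · exact le_trans (by positivity) (gain e a x y b hxy)

/-- A biased nearest-neighbour walk on `ℤ` is transient: there is a bounded superharmonic function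
which is strictly superharmonic at a given site. -/
lemma exists_superharmonic {p q : ℝ} (hp : 0 < p) (hq : 0 < q) (hpq : p ≠ q) (u₀ : ℤ) :
    ∃ (ψ : ℤ → ℝ) (κ : ℝ), 0 < κ ∧ (∀ u, 0 ≤ ψ u ∧ ψ u ≤ 1) ∧
      (∀ u, p * (ψ (u + 1) - ψ u) + q * (ψ (u - 1) - ψ u) ≤ 0) ∧
      p * (ψ (u₀ + 1) - ψ u₀) + q * (ψ (u₀ - 1) - ψ u₀) ≤ -κ := by
  wlog h : q < p generalizing p q u₀
  · obtain ⟨ψ, κ, hκ, hψ, h1, h2⟩ := this hq hp hpq.symm (-u₀) (lt_of_le_of_ne (not_lt.1 h) hpq)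
    refine ⟨fun u => ψ (-u), κ, hκ, fun u => hψ _, fun u => ?_, ?_⟩
    · have := h1 (-u)
      simp only
      rw [show -(u + 1) = -u - 1 by ring, show -(u - 1) = -u + 1 by ring]
      linarith
    · simp only
      rw [show -(u₀ + 1) = -u₀ - 1 by ring, show -(u₀ - 1) = -u₀ + 1 by ring]
      linarith
  set ρ : ℝ := q / p with hρ
  have hρ0 : 0 < ρ := by positivity
  have hρ1 : ρ < 1 := (div_lt_one hp).2 h
  have hpρ : p * ρ = q := by rw [hρ]; field_simp
  -- The probability that the walk started in `u` ever visits `u₀`.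
  set ψ : ℤ → ℝ := fun u => ρ ^ (u - u₀).toNat with hψ
  have hle : ∀ u ≤ u₀, ψ u = 1 := fun u hu => by
    simp only [hψ, show (u - u₀).toNat = 0 by lia, pow_zero]
  have hsucc : ∀ u, u₀ ≤ u → ψ (u + 1) = ψ u * ρ := fun u hu => by
    simp only [hψ, show (u + 1 - u₀).toNat = (u - u₀).toNat + 1 by lia, pow_succ]
  have h0 : p * (ψ (u₀ + 1) - ψ u₀) + q * (ψ (u₀ - 1) - ψ u₀) ≤ -(p - q) := by
    rw [hsucc u₀ le_rfl, hle u₀ le_rfl, hle (u₀ - 1) (by lia)]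
    linarith
  refine ⟨ψ, p - q, by linarith, fun u => ⟨by positivity, pow_le_one₀ hρ0.le hρ1.le⟩,
    fun u => ?_, h0⟩
  rcases lt_trichotomy u u₀ with hu | rfl | hu
  · rw [hle _ hu.le, hle (u + 1) (by lia), hle (u - 1) (by lia)]
    simp
  · linarith
  · obtain ⟨w, rfl⟩ : ∃ w, u = w + 1 := ⟨u - 1, by ring⟩
    rw [add_sub_cancel_right, hsucc (w + 1) (by lia), hsucc w (by lia), ← hpρ]
    apply le_of_eq
    ring

/-- The local energies whose sum counts each interface `(u, u + 1)` with the weight `c + ψ x u`,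
where `x` is the type at `u`. -/
noncomputable def interfaceEnergy (c : ℝ) (ψ : Bool → ℤ → ℝ) (u : ℤ) (x y : Bool) : ℝ :=
  if x = y then 0 else c + ψ x u

lemma flipEnergy_annihilate (c : ℝ) (ψ : Bool → ℤ → ℝ) (u : ℤ) {a x b : Bool} (ha : a ≠ x)
    (hb : b ≠ x) :
    flipEnergy (interfaceEnergy c ψ) u a x b = -(2 * c + ψ a (u - 1) + ψ x u) := by
  cases a <;> cases x <;> cases b <;> simp [flipEnergy, interfaceEnergy] at ha hb ⊢ <;> ring

lemma flipEnergy_move (c : ℝ) (ψ : Bool → ℤ → ℝ) (u : ℤ) {x b : Bool} (h : x ≠ b) :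
    flipEnergy (interfaceEnergy c ψ) u x x b = ψ x (u - 1) - ψ x u := by
  cases x <;> cases b <;> simp [flipEnergy, interfaceEnergy] at h ⊢ <;> ring

lemma flipEnergy_move' (c : ℝ) (ψ : Bool → ℤ → ℝ) (u : ℤ) {a x : Bool} (h : a ≠ x) :
    flipEnergy (interfaceEnergy c ψ) u a x x = ψ a u - ψ a (u - 1) := by
  cases a <;> cases x <;> simp [flipEnergy, interfaceEnergy] at h ⊢ <;> ring

/-- In the presence of a drift, interfaces that are not close to each other move like biased walks,
and interfaces that are close to each other annihilate at a positive rate. Hence a large multiple of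
the number of interfaces plus superharmonic functions of their positions decreases in mean, and
strictly so if there is an interface at `e₀`. -/
lemma exists_isLyapunov_interface {α γ : ℝ} (hα : 0 ≤ α) (hγ : 0 ≤ γ) (h : α ≠ γ) (e₀ : ℤ) :
    ∃ (c : ℝ) (ψ : Bool → ℤ → ℝ) (κ : ℝ), ∀ s, 0 < s →
      IsLyapunov α γ (interfaceEnergy c ψ) {e₀} s (s * κ) := by
  have hp : 0 < (1 + γ) / 2 := by positivity
  have hq : 0 < (1 + α) / 2 := by positivity
  have hpq : (1 + γ) / 2 ≠ (1 + α) / 2 := fun h' => h (by linarith)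
  obtain ⟨ψ, κ, hκ, hψ, h1, h2⟩ := exists_superharmonic hp hq hpq e₀
  obtain ⟨φ, κ', hκ', hφ, h1', h2'⟩ := exists_superharmonic hq hp hpq.symm e₀
  set c : ℝ := 2 + α + γ with hc
  set χ : Bool → ℤ → ℝ := fun x => if x then ψ else φ with hχ
  set k : ℝ := min (min κ κ') 1 with hk
  have hk0 : 0 < k := by positivity
  have hkκ : k ≤ κ := (min_le_left _ _).trans (min_le_left _ _)
  have hkκ' : k ≤ κ' := (min_le_left _ _).trans (min_le_right _ _)
  have hk1 : k ≤ 1 := min_le_right _ _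
  have hχ0 : ∀ x u, 0 ≤ χ x u := fun x u => by
    cases x
    · exact (hφ u).1
    · exact (hψ u).1
  have hχ1 : ∀ x u, χ x u ≤ 1 := fun x u => by
    cases x
    · exact (hφ u).2
    · exact (hψ u).2
  have drift : ∀ e a x y b, x ≠ y → edgeTerm α γ id (interfaceEnergy c χ) e a x y b ≤ 0 ∧
      (e = e₀ → edgeTerm α γ id (interfaceEnergy c χ) e a x y b ≤ -k) := by
    intro e a x y b hxy
    by_cases hreg : a = x ∧ b = y
    · obtain ⟨rfl, rfl⟩ := hreg
      have k1 := h1 e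
      have k2 := h1' e
      have heq : edgeTerm α γ id (interfaceEnergy c χ) e a a b b
          = if a then (1 + γ) / 2 * (ψ (e + 1) - ψ e) + (1 + α) / 2 * (ψ (e - 1) - ψ e)
            else (1 + α) / 2 * (φ (e + 1) - φ e) + (1 + γ) / 2 * (φ (e - 1) - φ e) := by
        cases a <;> cases b <;>
          simp [edgeTerm, flipEnergy, interfaceEnergy, pushRate, val, hχ] at hxy ⊢ <;> ring
      rw [heq]
      refine ⟨by split_ifs <;> linarith, ?_⟩
      rintro rfl
      split_ifs <;> linarith
    · have hT : edgeTerm α γ id (interfaceEnergy c χ) e a x y b ≤ -1 := by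
        have b1 := pushRate_le hα hγ x y b
        have b2 := pushRate_le hα hγ y x a
        have l1 := half_le_pushRate hα hγ hxy b
        have l2 := half_le_pushRate hα hγ hxy.symm a
        -- One of the two flips annihilates a pair of interfaces.
        have key : ∀ p p' z z' : ℝ, 1 / 2 ≤ p → 1 / 2 ≤ p' → p' ≤ 1 + α + γ → z ≤ -(2 * c) →
            z' ≤ 1 → p * z + p' * z' ≤ -1 := fun p p' z z' hp hp' hp'' hz hz' => by
          have e1 : 1 / 2 * (2 * c) ≤ p * -z :=
            mul_le_mul hp (by linarith) (by positivity) (by linarith)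
          have e2 : p' * z' ≤ p' * 1 := mul_le_mul_of_nonneg_left hz' (by linarith)
          linarith
        have hc0 : 0 ≤ c := by positivity
        simp only [edgeTerm, id]
        by_cases ha : a = x
        · have hb : b = x := bool_eq_of_ne (fun hb => hreg ⟨ha, hb⟩) hxy
          rw [ha, hb, add_comm]
          refine key _ _ _ _ (ha ▸ l2) (hb ▸ l1) (hb ▸ b1) ?_ ?_
          · rw [flipEnergy_annihilate c χ _ hxy hxy]
            linarith [hχ0 x (e + 1 - 1), hχ0 y (e + 1)]
          · rw [flipEnergy_move c χ _ hxy]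
            linarith [hχ0 x e, hχ1 x (e - 1)]
        · have ha' : a = y := bool_eq_of_ne ha hxy.symm
          rw [ha']
          refine key _ _ _ _ l1 (ha' ▸ l2) (ha' ▸ b2) ?_ ?_
          · rw [flipEnergy_annihilate c χ _ hxy.symm hxy.symm]
            linarith [hχ0 y (e - 1), hχ0 x e]
          · by_cases hb : b = y
            · rw [hb, flipEnergy_move' c χ _ hxy, add_sub_cancel_right]
              linarith [hχ0 x e, hχ1 x (e + 1)]
            · have hb' : b = x := bool_eq_of_ne hb hxy
              rw [hb', flipEnergy_annihilate c χ _ hxy hxy]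
              linarith [hχ0 x (e + 1 - 1), hχ0 y (e + 1)]
      exact ⟨by linarith, fun _ => by linarith⟩
  refine ⟨c, χ, k, fun s hs => ⟨fun u x y => ?_, fun u x y hxy => ?_, hs, mul_pos hs hk0,
    fun e a x y b hxy => ?_, fun e he a x y b hxy => ?_⟩⟩
  · unfold interfaceEnergy
    split_ifs
    · exact le_rfl
    · have := hχ0 x u
      positivity
  · unfold interfaceEnergy
    rw [if_neg hxy]
    linarith [hχ0 x u]
  · refine le_trans ?_ (neg_mul_edgeTerm_le hα hγ s _ e a x y b)
    have := mul_nonneg hs.le (neg_nonneg.2 (drift e a x y b hxy).1)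
    linarith
  · refine le_trans ?_ (neg_mul_edgeTerm_le hα hγ s _ e a x y b)
    have := mul_le_mul_of_nonneg_left ((drift e a x y b hxy).2 he) hs.le
    linarith

/-! ### Dynkin's formula and occupation measures -/

section

variable {Ω : Type*} [mΩ : MeasurableSpace Ω] {P : Measure Ω} {X : ℝ≥0 → Ω → Config ℤ}

lemma measurable_comp_countable (hm : ∀ t, Measurable (X t)) {k : ℝ≥0 → ℕ} (hk : Measurable k)
    (c : ℕ → ℝ≥0) (u : ℤ) : Measurable fun z : ℝ≥0 × Ω => X (c (k z.1)) z.2 u := by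
  have h1 : Measurable fun w : ℕ × Ω => X (c w.1) w.2 u :=
    measurable_from_prod_countable_right fun j => measurable_pi_iff.1 (hm (c j)) u
  exact h1.comp ((hk.comp measurable_fst).prodMk measurable_snd)

/-- A process with right-continuous paths is jointly measurable in time and chance. -/
lemma measurable_uncurry_of_rightContinuous
    (hrc : ∀ (ω : Ω) (t : ℝ≥0), ContinuousWithinAt (fun s => X s ω) (Set.Ici t) t)
    (hm : ∀ t, Measurable (X t)) : Measurable fun z : ℝ≥0 × Ω => X z.1 z.2 := by
  refine measurable_pi_iff.2 fun u => ?_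
  -- Approximation of the time from the right by multiples of `1 / (n + 1)`.
  set T : ℕ → ℝ≥0 → ℝ≥0 := fun n t => ((⌊((n : ℝ≥0) + 1) * t⌋₊ : ℝ≥0) + 1) / (n + 1) with hT
  have hTge : ∀ n t, t ≤ T n t := fun n t => by
    simp only [hT]
    rw [le_div_iff₀ (by positivity), mul_comm]
    exact (Nat.lt_floor_add_one _).le
  have hTle : ∀ n t, T n t ≤ t + 1 / ((n : ℝ≥0) + 1) := fun n t => by
    simp only [hT]
    rw [div_le_iff₀ (by positivity), add_mul t, div_mul_cancel₀ _ (by positivity), mul_comm t]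
    gcongr
    exact Nat.floor_le (by positivity)
  have hTlim : ∀ t, Tendsto (fun n => T n t) atTop (𝓝[≥] t) := fun t => by
    refine tendsto_nhdsWithin_iff.2 ⟨?_, Eventually.of_forall fun n => hTge n t⟩
    refine tendsto_of_tendsto_of_tendsto_of_le_of_le tendsto_const_nhds ?_
      (fun n => hTge n t) (fun n => hTle n t)
    have := (tendsto_one_div_add_atTop_nhds_zero_nat (𝕜 := ℝ≥0)).const_add t
    rwa [add_zero] at this
  refine measurable_of_tendsto_metrizable (f := fun n (z : ℝ≥0 × Ω) => X (T n z.1) z.2 u)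
    (fun n => ?_) (tendsto_pi_nhds.2 fun z => ?_)
  · exact measurable_comp_countable hm (Nat.measurable_floor.comp (measurable_id.const_mul _))
      (fun k => ((k : ℝ≥0) + 1) / (n + 1)) u
  · exact ((continuous_apply u).continuousAt.tendsto.comp
      ((hrc z.2 z.1).tendsto.comp (hTlim z.1)))

/-- The occupation measure of the process in the time interval `(τ, t]`, on the event `A`. -/
noncomputable def occupation (P : Measure Ω) (X : ℝ≥0 → Ω → Config ℤ) (A : Set Ω) (τ t : ℝ≥0) :
    Measure (Config ℤ) :=
  ((volume.restrict (Set.Ioc (τ : ℝ) t)).prod (P.restrict A)).map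
    fun z : ℝ × Ω => X z.1.toNNReal z.2

instance [IsFiniteMeasure P] (A : Set Ω) (τ t : ℝ≥0) :
    IsFiniteMeasure (occupation P X A τ t) := by
  unfold occupation
  infer_instance

lemma integrable_comp_of_bound {E : Type*} [MeasurableSpace E] {μ : Measure E} [IsFiniteMeasure μ]
    {Y : E → Config ℤ} (hY : Measurable Y) {F : Config ℤ → ℝ} (hF : Measurable F) {C : ℝ}
    (hC : ∀ x, |F x| ≤ C) : Integrable (fun z => F (Y z)) μ :=
  Integrable.of_bound (hF.comp hY).aestronglyMeasurable C (ae_of_all _ fun z => hC (Y z))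

lemma measurable_uncurry_toNNReal (hX : Measurable fun z : ℝ≥0 × Ω => X z.1 z.2) :
    Measurable fun z : ℝ × Ω => X z.1.toNNReal z.2 :=
  hX.comp ((measurable_real_toNNReal.comp measurable_fst).prodMk measurable_snd)

lemma integral_occupation [IsFiniteMeasure P] (hX : Measurable fun z : ℝ≥0 × Ω => X z.1 z.2)
    {F : Config ℤ → ℝ} (hF : Measurable F) {C : ℝ} (hC : ∀ x, |F x| ≤ C) (A : Set Ω)
    {τ t : ℝ≥0} (h : τ ≤ t) :
    ∫ x, F x ∂(occupation P X A τ t)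
      = ∫ r in (τ : ℝ)..t, ∫ ω in A, F (X r.toNNReal ω) ∂P := by
  have hY := measurable_uncurry_toNNReal hX
  unfold occupation
  rw [integral_map hY.aemeasurable hF.aestronglyMeasurable,
    integral_prod _ (integrable_comp_of_bound hY hF hC),
    intervalIntegral.integral_of_le (NNReal.coe_le_coe.2 h)]

lemma integral_occupation_swap [IsFiniteMeasure P] (hX : Measurable fun z : ℝ≥0 × Ω => X z.1 z.2)
    {F : Config ℤ → ℝ} (hF : Measurable F) {C : ℝ} (hC : ∀ x, |F x| ≤ C) (A : Set Ω)
    {τ t : ℝ≥0} (h : τ ≤ t) :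
    ∫ x, F x ∂(occupation P X A τ t)
      = ∫ ω in A, (∫ r in (τ : ℝ)..t, F (X r.toNNReal ω)) ∂P := by
  have hY := measurable_uncurry_toNNReal hX
  unfold occupation
  rw [integral_map hY.aemeasurable hF.aestronglyMeasurable,
    integral_prod_symm _ (integrable_comp_of_bound hY hF hC)]
  simp only [intervalIntegral.integral_of_le (NNReal.coe_le_coe.2 h)]

/-- The process `X` is jointly measurable, adapted to `ℱ` and satisfies Dynkin's formula for
cylinder functions, between any two times and conditionally on the past. -/
structure HasDynkin (α γ : ℝ) (P : Measure Ω) (X : ℝ≥0 → Ω → Config ℤ)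
    (ℱ : Filtration ℝ≥0 mΩ) : Prop where
  measurable_uncurry : Measurable fun z : ℝ≥0 × Ω => X z.1 z.2
  adapted : ∀ t, Measurable[ℱ t] (X t)
  dynkin : ∀ τ t : ℝ≥0, τ ≤ t → ∀ A, MeasurableSet[ℱ τ] A → ∀ f, IsCylinder f →
    ∫ x, f x ∂(P.restrict A).map (X t) = ∫ x, f x ∂(P.restrict A).map (X τ)
      + ∫ x, pregenerator nnKernel (coopKernel nnKernel) α γ f x ∂(occupation P X A τ t)

lemma IsCVMBC.exists_hasDynkin {α γ : ℝ} [IsProbabilityMeasure P]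
    (hX : IsCVMBC nnKernel α γ P X) : ∃ ℱ : Filtration ℝ≥0 mΩ, HasDynkin α γ P X ℱ := by
  obtain ⟨hrc, -, ℱ, hadapt, hmart⟩ := hX
  have hm : ∀ t, Measurable (X t) := fun t => (hadapt t).mono (ℱ.le t) le_rfl
  have hmeas := measurable_uncurry_of_rightContinuous hrc hm
  refine ⟨ℱ, hmeas, hadapt, fun τ t hτt A hA f hf => ?_⟩
  set G := pregenerator nnKernel (coopKernel nnKernel) α γ f with hG
  have hGcyl : IsCylinder G := hf.pregenerator_nn
  obtain ⟨C, hC⟩ := hf.bounded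
  obtain ⟨D, hD⟩ := hGcyl.bounded
  have hfi : ∀ r, Integrable (fun ω => f (X r ω)) P := fun r =>
    integrable_comp_of_bound (hm r) hf.measurable hC
  have hIi : ∀ r : ℝ≥0, Integrable (fun ω => ∫ s in (0 : ℝ)..r, G (X s.toNNReal ω)) P := by
    intro r
    have := (hfi r).sub ((hmart f hf).integrable r)
    refine this.congr (ae_of_all _ fun ω => ?_)
    simp [hG]
  have hsplit : ∀ ω, ∫ s in (0 : ℝ)..t, G (X s.toNNReal ω)
      = (∫ s in (0 : ℝ)..τ, G (X s.toNNReal ω)) + ∫ s in (τ : ℝ)..t, G (X s.toNNReal ω) := by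
    intro ω
    have hint : ∀ a b : ℝ, IntervalIntegrable (fun s => G (X s.toNNReal ω)) volume a b := by
      intro a b
      have hYω : Measurable fun s : ℝ => X s.toNNReal ω :=
        (measurable_uncurry_toNNReal hmeas).comp (measurable_id.prodMk measurable_const)
      exact ⟨integrable_comp_of_bound hYω hGcyl.measurable hD,
        integrable_comp_of_bound hYω hGcyl.measurable hD⟩
    exact (intervalIntegral.integral_add_adjacent_intervals (hint _ _) (hint _ _)).symm
  have h1 := (hmart f hf).setIntegral_eq hτt hA
  rw [integral_sub (hfi τ).integrableOn (hIi τ).integrableOn,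
    integral_sub (hfi t).integrableOn (hIi t).integrableOn] at h1
  have h2 : ∫ ω in A, (∫ s in (0 : ℝ)..t, G (X s.toNNReal ω)) ∂P
      = ∫ ω in A, (∫ s in (0 : ℝ)..τ, G (X s.toNNReal ω)) ∂P
        + ∫ x, G x ∂(occupation P X A τ t) := by
    rw [integral_occupation_swap hmeas hGcyl.measurable hD A hτt, ← integral_add
      (hIi τ).integrableOn]
    · simp only [hsplit]
    · have := ((hIi t).sub (hIi τ)).integrableOn (s := A)
      refine this.congr (ae_of_all _ fun ω => ?_)
      simp only [Pi.sub_apply, hsplit ω]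
      ring
  rw [integral_map (hm t).aemeasurable hf.measurable.aestronglyMeasurable,
    integral_map (hm τ).aemeasurable hf.measurable.aestronglyMeasurable]
  linarith

end

/-! ### Growth of the exponential energies along the process -/

namespace HasDynkin

variable {Ω : Type*} [mΩ : MeasurableSpace Ω] {P : Measure Ω}
  {X : ℝ≥0 → Ω → Config ℤ} {ℱ : Filtration ℝ≥0 mΩ} {α γ : ℝ}

lemma measurable (h : HasDynkin α γ P X ℱ) (t : ℝ≥0) : Measurable (X t) :=
  (h.adapted t).mono (ℱ.le t) le_rfl

lemma measurable_expEnergy_mul (s : ℝ) (v : ℤ → Bool → Bool → ℝ) (Q : Set ℤ) :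
    Measurable fun x => expEnergy s v x * hasInterface Q x :=
  (measurable_expEnergy s v).mul (measurable_hasInterface Q)

lemma abs_expEnergy_le {v : ℤ → Bool → Bool → ℝ} {s : ℝ} (hs : 0 ≤ s)
    (hv : ∀ u x y, 0 ≤ v u x y) (x : Config ℤ) : |expEnergy s v x| ≤ 1 := by
  rw [abs_of_nonneg (expEnergy_nonneg _ _ _)]
  exact expEnergy_le_one hs hv x

lemma abs_expEnergy_mul_hasInterface_le {v : ℤ → Bool → Bool → ℝ} {s : ℝ} (hs : 0 ≤ s)
    (hv : ∀ u x y, 0 ≤ v u x y) (Q : Set ℤ) (x : Config ℤ) :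
    |expEnergy s v x * hasInterface Q x| ≤ 1 := by
  rw [abs_of_nonneg (mul_nonneg (expEnergy_nonneg _ _ _) (hasInterface_nonneg _ _))]
  exact mul_le_one₀ (expEnergy_le_one hs hv x) (hasInterface_nonneg _ _) (hasInterface_le_one _ _)

variable [IsProbabilityMeasure P]

/-- `IsLyapunov.integral_expEnergy_le` for the process, on an event of the past. -/
lemma growth (h : HasDynkin α γ P X ℱ) (hα : 0 ≤ α) (hγ : 0 ≤ γ) {v : ℤ → Bool → Bool → ℝ}
    {Q : Set ℤ} {s κ : ℝ} (hv : IsLyapunov α γ v Q s κ) {τ t : ℝ≥0} (hτt : τ ≤ t) {A : Set Ω}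
    (hA : MeasurableSet[ℱ τ] A) :
    ∫ ω in A, expEnergy s v (X τ ω) ∂P
        + κ * ∫ r in (τ : ℝ)..t,
          ∫ ω in A, expEnergy s v (X r.toNNReal ω) * hasInterface Q (X r.toNNReal ω) ∂P
      ≤ ∫ ω in A, expEnergy s v (X t ω) ∂P := by
  have key := hv.integral_expEnergy_le hα hγ fun f hf => h.dynkin τ t hτt A hA f hf
  rwa [integral_map (h.measurable t).aemeasurable (measurable_expEnergy s v).aestronglyMeasurable,
    integral_map (h.measurable τ).aemeasurable (measurable_expEnergy s v).aestronglyMeasurable,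
    integral_occupation h.measurable_uncurry
      (measurable_expEnergy_mul s v Q)
      (abs_expEnergy_mul_hasInterface_le hv.pos.le hv.nonneg Q) A hτt] at key

lemma expEnergy_mono (h : HasDynkin α γ P X ℱ) (hα : 0 ≤ α) (hγ : 0 ≤ γ)
    {v : ℤ → Bool → Bool → ℝ} {Q : Set ℤ} {s κ : ℝ} (hv : IsLyapunov α γ v Q s κ) {τ t : ℝ≥0}
    (hτt : τ ≤ t) {A : Set Ω} (hA : MeasurableSet[ℱ τ] A) :
    ∫ ω in A, expEnergy s v (X τ ω) ∂P ≤ ∫ ω in A, expEnergy s v (X t ω) ∂P := by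
  have h1 := h.growth hα hγ hv hτt hA
  have h2 : 0 ≤ ∫ r in (τ : ℝ)..t,
      ∫ ω in A, expEnergy s v (X r.toNNReal ω) * hasInterface Q (X r.toNNReal ω) ∂P :=
    intervalIntegral.integral_nonneg (NNReal.coe_le_coe.2 hτt) fun r _ =>
      integral_nonneg fun ω => mul_nonneg (expEnergy_nonneg _ _ _) (hasInterface_nonneg _ _)
  have := mul_nonneg hv.gain_pos.le h2
  linarith

lemma integrable_expEnergy (h : HasDynkin α γ P X ℱ) {v : ℤ → Bool → Bool → ℝ} {s : ℝ} (hs : 0 ≤ s)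
    (hv : ∀ u x y, 0 ≤ v u x y) (t : ℝ≥0) (A : Set Ω) :
    Integrable (fun ω => expEnergy s v (X t ω)) (P.restrict A) :=
  integrable_comp_of_bound (h.measurable t) (measurable_expEnergy s v) (abs_expEnergy_le hs hv)

lemma integrable_expEnergy_mul (h : HasDynkin α γ P X ℱ) {v : ℤ → Bool → Bool → ℝ} {s : ℝ}
    (hs : 0 ≤ s) (hv : ∀ u x y, 0 ≤ v u x y) (Q : Set ℤ) (t : ℝ≥0) (A : Set Ω) :
    Integrable (fun ω => expEnergy s v (X t ω) * hasInterface Q (X t ω)) (P.restrict A) :=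
  integrable_comp_of_bound (h.measurable t)
    (measurable_expEnergy_mul s v Q)
    (abs_expEnergy_mul_hasInterface_le hs hv Q)

/-- The time during which there is an interface in `Q`, weighted by `exp (-s V)`, has a mean that
is bounded uniformly in the time horizon. -/
lemma occupation_le (h : HasDynkin α γ P X ℱ) (hα : 0 ≤ α) (hγ : 0 ≤ γ)
    {v : ℤ → Bool → Bool → ℝ} {Q : Set ℤ} {s κ : ℝ} (hv : IsLyapunov α γ v Q s κ) (t : ℝ≥0)
    {A : Set Ω} (hA : MeasurableSet[ℱ 0] A) :
    ∫ r in (0 : ℝ)..t,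
      ∫ ω in A, expEnergy s v (X r.toNNReal ω) * hasInterface Q (X r.toNNReal ω) ∂P ≤ 1 / κ := by
  have h1 := h.growth hα hγ hv (t := t) zero_le hA
  have h2 : 0 ≤ ∫ ω in A, expEnergy s v (X 0 ω) ∂P :=
    integral_nonneg fun ω => expEnergy_nonneg _ _ _
  have h3 : ∫ ω in A, expEnergy s v (X t ω) ∂P ≤ 1 := by
    calc ∫ ω in A, expEnergy s v (X t ω) ∂P ≤ ∫ ω in A, (1 : ℝ) ∂P :=
          integral_mono (h.integrable_expEnergy hv.pos.le hv.nonneg t A) (integrable_const _)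
            fun ω => expEnergy_le_one hv.pos.le hv.nonneg _
      _ ≤ 1 := by
          simp only [integral_const, smul_eq_mul, mul_one]
          rw [measureReal_restrict_apply_univ]
          exact measureReal_le_one
  rw [le_div_iff₀ hv.gain_pos, mul_comm]
  rw [NNReal.coe_zero] at h1
  linarith

lemma intervalIntegrable_occupation (h : HasDynkin α γ P X ℱ) {v : ℤ → Bool → Bool → ℝ} {s : ℝ}
    (hs : 0 ≤ s) (hv : ∀ u x y, 0 ≤ v u x y) (Q : Set ℤ) (A : Set Ω) (a b : ℝ) :
    IntervalIntegrable (fun r : ℝ => ∫ ω in A,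
      expEnergy s v (X r.toNNReal ω) * hasInterface Q (X r.toNNReal ω) ∂P) volume a b := by
  have hY := measurable_uncurry_toNNReal h.measurable_uncurry
  have hF := measurable_expEnergy_mul s v Q
  have hb := abs_expEnergy_mul_hasInterface_le hs hv Q
  constructor
  all_goals exact (integrable_comp_of_bound
    (μ := (volume.restrict (Set.Ioc _ _)).prod (P.restrict A)) hY hF hb).integral_prod_left

/-- If the energy is finite at time zero, then for small `s` the function `exp (-s V)` is close to
`1` in mean at time zero, and hence at all times. -/
lemma exists_expEnergy_ge (h : HasDynkin α γ P X ℱ) (hα : 0 ≤ α) (hγ : 0 ≤ γ)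
    {v : ℤ → Bool → Bool → ℝ} {Q : Set ℤ} {κ : ℝ → ℝ}
    (hv : ∀ s, 0 < s → IsLyapunov α γ v Q s (κ s)) {A : Set Ω} (hA : MeasurableSet[ℱ 0] A)
    (hfin : ∀ᵐ ω ∂P.restrict A, ∃ M, ∀ L, energy v L (X 0 ω) ≤ M) {ε : ℝ} (hε : 0 < ε) :
    ∃ s, 0 < s ∧ ∀ t, P.real A - ε ≤ ∫ ω in A, expEnergy s v (X t ω) ∂P := by
  have hnn := (hv 1 one_pos).nonneg
  have hlim : Tendsto (fun n : ℕ => ∫ ω in A, expEnergy (1 / ((n : ℝ) + 1)) v (X 0 ω) ∂P) atTop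
      (𝓝 (∫ ω in A, (1 : ℝ) ∂P)) := by
    refine tendsto_integral_of_dominated_convergence (fun _ => 1)
      (fun n => ((measurable_expEnergy _ v).comp (h.measurable 0)).aestronglyMeasurable)
      (integrable_const _)
      (fun n => ae_of_all _ fun ω => abs_expEnergy_le (by positivity) hnn _) ?_
    filter_upwards [hfin] with ω ⟨M, hM⟩
    have h1 : Tendsto (fun n : ℕ => Real.exp (-(1 / ((n : ℝ) + 1)) * M)) atTop (𝓝 1) := by
      have := (tendsto_one_div_add_atTop_nhds_zero_nat (𝕜 := ℝ)).neg.mul_const M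
      rw [neg_zero, zero_mul] at this
      have := (Real.continuous_exp.tendsto 0).comp this
      rwa [Real.exp_zero] at this
    refine tendsto_of_tendsto_of_tendsto_of_le_of_le h1 tendsto_const_nhds (fun n => ?_)
      fun n => expEnergy_le_one (by positivity) hnn _
    refine le_ciInf fun L => Real.exp_le_exp.2 ?_
    have : (0 : ℝ) ≤ 1 / ((n : ℝ) + 1) := by positivity
    nlinarith [hM L]
  have hlim1 : ∫ ω in A, (1 : ℝ) ∂P = P.real A := by
    simp
  rw [hlim1] at hlim
  obtain ⟨n, hn⟩ := (hlim.eventually (lt_mem_nhds (by linarith : P.real A - ε < P.real A))).exists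
  have hs : (0 : ℝ) < 1 / ((n : ℝ) + 1) := by positivity
  exact ⟨_, hs, fun t => hn.le.trans (h.expEnergy_mono hα hγ (hv _ hs) zero_le hA)⟩

end HasDynkin

/-! ### Clustering -/

/-- A function that decreases at most linearly and is dominated, up to `ε`, by an integrable
function is eventually small. -/
lemma eventually_lt_of_le_integrable {h g : ℝ → ℝ} {C K ε : ℝ} (hC : 0 < C) (hε : 0 < ε)
    (hg0 : ∀ r, 0 ≤ g r) (hgi : ∀ a b, IntervalIntegrable g volume a b)
    (hgK : ∀ T, 0 ≤ T → ∫ r in (0 : ℝ)..T, g r ≤ K)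
    (hlip : ∀ t r, 0 ≤ t → t ≤ r → h t - C * (r - t) ≤ h r)
    (hle : ∀ r, 0 ≤ r → h r ≤ g r + ε) : ∀ᶠ t in atTop, h t < 3 * ε := by
  set G : ℝ → ℝ := fun T => ∫ r in (0 : ℝ)..T, g r with hG
  have hsub : ∀ a b, G b - G a = ∫ r in a..b, g r := fun a b =>
    intervalIntegral.integral_interval_sub_left (hgi _ _) (hgi _ _)
  have hmono : Monotone G := fun a b hab => by
    have := intervalIntegral.integral_nonneg (μ := volume) hab fun r _ => hg0 r
    linarith [hsub a b]
  have hbdd : BddAbove (Set.range G) := by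
    refine ⟨K, ?_⟩
    rintro _ ⟨T, rfl⟩
    exact (hmono (le_max_left T 0)).trans (hgK _ (le_max_right _ _))
  have hlim := tendsto_atTop_ciSup hmono hbdd
  set δ : ℝ := ε / C with hδ
  have hδ0 : 0 < δ := by positivity
  have hCδ : C * δ = ε := by rw [hδ]; field_simp
  have hdiff := (hlim.comp (tendsto_atTop_add_const_right atTop δ tendsto_id)).sub hlim
  rw [sub_self] at hdiff
  filter_upwards [hdiff.eventually (gt_mem_nhds (by positivity : 0 < ε * δ)),
    eventually_ge_atTop 0] with T hT hT0
  by_contra hcon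
  rw [not_lt] at hcon
  simp only [Function.comp, id] at hT
  rw [hsub] at hT
  have hlow : ∫ r in T..(T + δ), ε ≤ ∫ r in T..(T + δ), g r := by
    refine intervalIntegral.integral_mono_on (by linarith) (by simp) (hgi _ _) fun r hr => ?_
    have h1 := hlip T r hT0 hr.1
    have h2 := hle r (hT0.trans hr.1)
    have h3 : C * (r - T) ≤ C * δ := mul_le_mul_of_nonneg_left (by linarith [hr.2]) hC.le
    linarith
  rw [intervalIntegral.integral_const, smul_eq_mul] at hlow
  linarith [mul_comm ε δ]

lemma IsLyapunov.mono {α γ : ℝ} {v : ℤ → Bool → Bool → ℝ} {Q Q' : Set ℤ} {s κ : ℝ}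
    (h : IsLyapunov α γ v Q s κ) (hQ : Q' ⊆ Q) : IsLyapunov α γ v Q' s κ :=
  ⟨h.nonneg, h.one_le, h.pos, h.gain_pos, h.edge_nonneg, fun e he => h.edge_gain e (hQ he)⟩

lemma isCylinder_hasInterface_singleton (e : ℤ) : IsCylinder (hasInterface {e}) :=
  ⟨{e, e + 1}, fun X Y h => by
    rw [hasInterface_singleton, hasInterface_singleton, h e (by simp), h (e + 1) (by simp)]⟩

lemma energy_le_of_finite {v : ℤ → Bool → Bool → ℝ} (hv : ∀ u x y, 0 ≤ v u x y) {x : Config ℤ}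
    (h : {u | v u (x u) (x (u + 1)) ≠ 0}.Finite) : ∃ M, ∀ L, energy v L x ≤ M := by
  refine ⟨∑ u ∈ h.toFinset, v u (x u) (x (u + 1)), fun L => ?_⟩
  unfold energy
  rw [← Finset.sum_filter_ne_zero]
  refine Finset.sum_le_sum_of_subset_of_nonneg (fun u hu => ?_) fun u _ _ => hv _ _ _
  exact h.mem_toFinset.2 (Finset.mem_filter.1 hu).2

lemma FinitelyMany.finite_or_succ {i : Bool} {x : Config ℤ} (h : FinitelyMany i x) :
    {u : ℤ | x u = i ∨ x (u + 1) = i}.Finite :=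
  h.union (h.preimage (add_left_injective (1 : ℤ)).injOn)

lemma FinitelyMany.energy_countEnergy_le {i : Bool} {x : Config ℤ} (h : FinitelyMany i x) :
    ∃ M, ∀ L, energy (countEnergy i) L x ≤ M := by
  refine energy_le_of_finite (fun u x y => ?_) (h.finite_or_succ.subset fun u hu => ?_)
  · unfold countEnergy
    split_ifs <;> norm_num
  · by_contra hcon
    simp only [Set.mem_ofPred_eq, not_or] at hcon
    exact hu (by simp [countEnergy, hcon.2, bool_eq_of_ne hcon.1 hcon.2])

lemma FinitelyMany.energy_interfaceEnergy_le {i : Bool} {x : Config ℤ} (h : FinitelyMany i x)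
    {c : ℝ} {ψ : Bool → ℤ → ℝ} (hv : ∀ u x y, 0 ≤ interfaceEnergy c ψ u x y) :
    ∃ M, ∀ L, energy (interfaceEnergy c ψ) L x ≤ M := by
  refine energy_le_of_finite hv (h.finite_or_succ.subset fun u hu => ?_)
  by_contra hcon
  simp only [Set.mem_ofPred_eq, not_or] at hcon
  exact hu (by simp [interfaceEnergy, bool_eq_of_ne hcon.1 hcon.2])

lemma measurableSet_finitelyMany (i : Bool) : MeasurableSet {x : Config ℤ | FinitelyMany i x} := by
  have : {x : Config ℤ | FinitelyMany i x} = ⋃ S : Finset ℤ, ⋂ u ∈ (S : Set ℤ)ᶜ, {x | x u = !i} := by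
    ext x
    simp only [Set.mem_ofPred_eq, Set.mem_iUnion, Set.mem_iInter, Set.mem_compl_iff, Finset.mem_coe]
    constructor
    · intro h
      exact ⟨h.toFinset, fun u hu => Bool.eq_not_of_ne fun hx => hu (h.mem_toFinset.2 hx)⟩
    · rintro ⟨S, hS⟩
      refine S.finite_toSet.subset fun u hu => ?_
      by_contra hcon
      have h1 := hS u hcon
      rw [hu] at h1
      cases i <;> simp at h1
  rw [this]
  exact MeasurableSet.iUnion fun S => MeasurableSet.biInter (Set.to_countable _) fun u _ =>
    measurable_pi_apply u (measurableSet_singleton _)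

section

variable {Ω : Type*} [mΩ : MeasurableSpace Ω] {P : Measure Ω}
  {X : ℝ≥0 → Ω → Config ℤ} {ℱ : Filtration ℝ≥0 mΩ} {α γ : ℝ}

lemma HasDynkin.measurableSet_interface (h : HasDynkin α γ P X ℱ) (e : ℤ) (t : ℝ≥0) :
    MeasurableSet {ω | X t ω e ≠ X t ω (e + 1)} :=
  h.measurable t (VMBC.measurableSet_interface e)

variable [IsProbabilityMeasure P]

/-- The probability of an interface at `e` tends to zero, since the mean time during which there
is one is finite up to an arbitrarily small error, and the probability is Lipschitz in time. -/
lemma HasDynkin.tendsto_interface (h : HasDynkin α γ P X ℱ) (hα : 0 ≤ α) (hγ : 0 ≤ γ)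
    {v : ℤ → Bool → Bool → ℝ} {e : ℤ} {κ : ℝ → ℝ}
    (hv : ∀ s, 0 < s → IsLyapunov α γ v {e} s (κ s)) {A : Set Ω} (hA : MeasurableSet[ℱ 0] A)
    (hfin : ∀ᵐ ω ∂P.restrict A, ∃ M, ∀ L, energy v L (X 0 ω) ≤ M) :
    Tendsto (fun t => P.real (A ∩ {ω | X t ω e ≠ X t ω (e + 1)})) atTop (𝓝 0) := by
  set p : ℝ≥0 → ℝ := fun t => ∫ ω in A, hasInterface {e} (X t ω) ∂P with hp
  have hJb : ∀ x, |hasInterface {e} x| ≤ 1 := fun x => by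
    rw [abs_of_nonneg (hasInterface_nonneg _ _)]
    exact hasInterface_le_one _ _
  have hJi : ∀ t, Integrable (fun ω => hasInterface {e} (X t ω)) (P.restrict A) := fun t =>
    integrable_comp_of_bound (h.measurable t) (measurable_hasInterface _) hJb
  have hpP : ∀ t, P.real (A ∩ {ω | X t ω e ≠ X t ω (e + 1)}) = p t := fun t => by
    have h1 : (fun ω => hasInterface {e} (X t ω))
        = {ω | X t ω e ≠ X t ω (e + 1)}.indicator 1 := by
      funext ω
      rw [hasInterface_singleton]
      simp [Set.indicator_apply]
    simp only [hp]
    rw [h1, integral_indicator_one (h.measurableSet_interface e t),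
      measureReal_restrict_apply (h.measurableSet_interface e t), Set.inter_comm]
  simp only [hpP]
  have hcyl := isCylinder_hasInterface_singleton e
  obtain ⟨D, hD⟩ := (hcyl.pregenerator_nn (α := α) (γ := γ)).bounded
  have hD0 : 0 ≤ D := (abs_nonneg _).trans (hD fun _ => true)
  have hlip : ∀ τ t : ℝ≥0, τ ≤ t → p τ - (D + 1) * (t - τ) ≤ p t := by
    intro τ t hτt
    have h1 := h.dynkin τ t hτt A (ℱ.mono zero_le _ hA) _ hcyl
    rw [integral_map (h.measurable t).aemeasurable
        (measurable_hasInterface _).aestronglyMeasurable,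
      integral_map (h.measurable τ).aemeasurable (measurable_hasInterface _).aestronglyMeasurable,
      integral_occupation h.measurable_uncurry hcyl.pregenerator_nn.measurable hD A hτt] at h1
    have hinner : ∀ r : ℝ, ‖∫ ω in A, pregenerator nnKernel (coopKernel nnKernel) α γ
        (hasInterface {e}) (X r.toNNReal ω) ∂P‖ ≤ D := fun r => by
      refine (norm_integral_le_of_norm_le_const (ae_of_all _ fun ω => hD _)).trans ?_
      rw [measureReal_restrict_apply_univ]
      exact mul_le_of_le_one_right hD0 measureReal_le_one
    have h2 := intervalIntegral.norm_integral_le_of_norm_le_const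
      (a := (τ : ℝ)) (b := (t : ℝ)) fun r _ => hinner r
    have hτt' : (τ : ℝ) ≤ t := NNReal.coe_le_coe.2 hτt
    rw [abs_of_nonneg (sub_nonneg.2 hτt')] at h2
    have h3 := (abs_le.1 h2).1
    simp only [hp]
    linarith
  have hp0 : ∀ t, 0 ≤ p t := fun t => integral_nonneg fun ω => hasInterface_nonneg _ _
  have hev : ∀ ε, 0 < ε → ∀ᶠ t in atTop, p t < 3 * ε := by
    intro ε hε
    obtain ⟨s, hs, hsA⟩ := h.exists_expEnergy_ge hα hγ hv hA hfin hε
    have hl := hv s hs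
    have hreal := eventually_lt_of_le_integrable (h := fun r => p r.toNNReal) (C := D + 1)
      (by positivity) hε
      (fun r => integral_nonneg fun ω => mul_nonneg (expEnergy_nonneg s v (X r.toNNReal ω))
        (hasInterface_nonneg {e} (X r.toNNReal ω)))
      (h.intervalIntegrable_occupation hs.le hl.nonneg {e} A)
      (K := 1 / κ s) (fun T hT => ?_) (fun t r ht htr => ?_) (fun r hr => ?_)
    · have := (NNReal.tendsto_coe_atTop.2 tendsto_id).eventually hreal
      simpa only [Real.toNNReal_coe, id] using this
    · have := h.occupation_le hα hγ hl T.toNNReal hA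
      rwa [Real.coe_toNNReal T hT] at this
    · have := hlip t.toNNReal r.toNNReal (Real.toNNReal_le_toNNReal htr)
      rwa [Real.coe_toNNReal t ht, Real.coe_toNNReal r (ht.trans htr)] at this
    · have h1 := hsA r.toNNReal
      have hi1 := h.integrable_expEnergy_mul hs.le hl.nonneg {e} r.toNNReal A
      have hi2 := h.integrable_expEnergy hs.le hl.nonneg r.toNNReal A
      have hi3 : Integrable (fun ω => 1 - expEnergy s v (X r.toNNReal ω)) (P.restrict A) :=
        (integrable_const _).sub hi2
      have h2 : p r.toNNReal ≤ ∫ ω in A, (expEnergy s v (X r.toNNReal ω)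
          * hasInterface {e} (X r.toNNReal ω) + (1 - expEnergy s v (X r.toNNReal ω))) ∂P := by
        refine integral_mono (hJi _) (hi1.add hi3) fun ω => ?_
        have e1 := expEnergy_le_one hs.le hl.nonneg (X r.toNNReal ω)
        have e2 := hasInterface_le_one {e} (X r.toNNReal ω)
        beta_reduce
        nlinarith
      rw [integral_add hi1 hi3, integral_sub (integrable_const _) hi2] at h2
      simp only [integral_const, smul_eq_mul, mul_one, measureReal_restrict_apply_univ] at h2
      linarith
  refine tendsto_order.2 ⟨fun a ha => Eventually.of_forall fun t => ha.trans_le (hp0 t),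
    fun a ha => ?_⟩
  filter_upwards [hev (a / 3) (by positivity)] with t ht
  linarith

lemma exists_interface_of_ne {x : Config ℤ} {u v : ℤ} (huv : u ≤ v) (h : x u ≠ x v) :
    ∃ e ∈ Finset.Ico u v, x e ≠ x (e + 1) := by
  by_contra hcon
  push Not at hcon
  refine h ?_
  refine Int.leInduction (m := u) (motive := fun n _ => n ≤ v → x u = x n) (fun _ => rfl)
    (fun n hn ih hnv => ?_) v huv le_rfl
  exact (ih (by lia)).trans (hcon n (Finset.mem_Ico.2 ⟨hn, by lia⟩))

lemma HasDynkin.clusters (h : HasDynkin α γ P X ℱ)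
    (hint : ∀ e, Tendsto (fun t => P.real {ω | X t ω e ≠ X t ω (e + 1)}) atTop (𝓝 0)) :
    Clusters P X := by
  have hle : ∀ u v : ℤ, u ≤ v → Tendsto (fun t => P {ω | X t ω u = X t ω v}) atTop (𝓝 1) := by
    intro u v huv
    have hlim : Tendsto (fun t => ∑ e ∈ Finset.Ico u v, P.real {ω | X t ω e ≠ X t ω (e + 1)})
        atTop (𝓝 0) := by
      simpa using tendsto_finsetSum (Finset.Ico u v) fun e _ => hint e
    have hm : ∀ t, MeasurableSet {ω | X t ω u = X t ω v} := fun t =>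
      measurableSet_eq_fun (measurable_pi_iff.1 (h.measurable t) u)
        (measurable_pi_iff.1 (h.measurable t) v)
    have h1 : Tendsto (fun t => P.real {ω | X t ω u = X t ω v}) atTop (𝓝 1) := by
      have := hlim.const_sub 1
      rw [sub_zero] at this
      refine tendsto_of_tendsto_of_tendsto_of_le_of_le this tendsto_const_nhds (fun t => ?_)
        fun t => measureReal_le_one
      have h2 : P.real {ω | X t ω u = X t ω v}ᶜ
          ≤ ∑ e ∈ Finset.Ico u v, P.real {ω | X t ω e ≠ X t ω (e + 1)} := by
        refine le_trans (measureReal_mono ?_ (measure_ne_top _ _)) (measureReal_biUnion_finset_le _ _)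
        intro ω hω
        obtain ⟨e, he, hx⟩ := exists_interface_of_ne huv hω
        exact Set.mem_biUnion he hx
      rw [probReal_compl_eq_one_sub (hm t)] at h2
      simp only
      linarith
    have h3 := ENNReal.tendsto_ofReal h1
    simpa only [measureReal_def, ENNReal.ofReal_toReal (measure_ne_top P _), ENNReal.ofReal_one]
      using h3
  intro u v
  rcases le_total u v with huv | huv
  · exact hle u v huv
  · simpa only [eq_comm] using hle v u huv

/-- The process clusters when started with finitely many individuals of one type. -/
lemma HasDynkin.clusters_of_finitelyMany (h : HasDynkin α γ P X ℱ) (hα : 0 ≤ α) (hγ : 0 ≤ γ)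
    (h0 : ∀ᵐ ω ∂P, FinitelyMany true (X 0 ω) ∨ FinitelyMany false (X 0 ω)) : Clusters P X := by
  refine h.clusters fun e => ?_
  by_cases hαγ : α = γ
  · -- Without drift the energy has to count the individuals of the type that is initially finite.
    have key : ∀ i : Bool, Tendsto (fun t => P.real ({ω | FinitelyMany i (X 0 ω)}
        ∩ {ω | X t ω e ≠ X t ω (e + 1)})) atTop (𝓝 0) := by
      intro i
      have hA : MeasurableSet[ℱ 0] {ω | FinitelyMany i (X 0 ω)} :=
        h.adapted 0 (measurableSet_finitelyMany i)
      have hi : if i then γ ≤ α else α ≤ γ := by split_ifs <;> simp [hαγ]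
      refine h.tendsto_interface hα hγ
        (fun s hs => (isLyapunov_countEnergy hα hγ hi hs).mono (Set.subset_univ _)) hA ?_
      exact (ae_restrict_iff' (ℱ.le 0 _ hA)).2
        (ae_of_all _ fun ω hω => FinitelyMany.energy_countEnergy_le hω)
    have hsum := (key true).add (key false)
    rw [add_zero] at hsum
    refine squeeze_zero (fun t => measureReal_nonneg) (fun t => ?_) hsum
    refine le_trans ?_ (measureReal_union_le _ _)
    refine ENNReal.toReal_mono (measure_ne_top P _) (measure_mono_ae ?_)
    filter_upwards [h0] with ω hω hx
    exact hω.imp (fun hω => ⟨hω, hx⟩) fun hω => ⟨hω, hx⟩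
  · obtain ⟨c, ψ, κ, hl⟩ := exists_isLyapunov_interface hα hγ hαγ e
    have hnn := (hl 1 one_pos).nonneg
    have := h.tendsto_interface hα hγ hl (A := Set.univ) MeasurableSet.univ ?_
    · simpa only [Set.univ_inter] using this
    · rw [Measure.restrict_univ]
      filter_upwards [h0] with ω hω
      exact hω.elim (fun hω => hω.energy_interfaceEnergy_le hnn)
        fun hω => hω.energy_interfaceEnergy_le hnn

/-! ### Extinction -/

lemma expEnergy_countEnergy_of_forall {i : Bool} {x : Config ℤ} (h : ∀ u, x u = !i) (s : ℝ) :
    expEnergy s (countEnergy i) x = 1 := by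
  unfold expEnergy energy
  have : ∀ u, countEnergy i u (x u) (x (u + 1)) = 0 := fun u => by
    rw [h, h]
    cases i <;> simp [countEnergy]
  simp [this]

lemma forall_of_expEnergy_countEnergy_pos {i : Bool} {x : Config ℤ} {s : ℝ} (hs : 0 < s)
    (hv : ∀ u x y, 0 ≤ countEnergy i u x y) (h : 0 < expEnergy s (countEnergy i) x)
    (hJ : ∀ e, x e = x (e + 1)) : ∀ u, x u = !i := by
  by_contra hcon
  push Not at hcon
  obtain ⟨u, hu⟩ := hcon
  have hu : x u = i := bool_eq_of_ne hu (by cases i <;> simp)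
  have hall : ∀ w, x w = i := fun w => by
    by_contra hw
    rcases le_total u w with huw | huw
    · obtain ⟨e, -, he⟩ := exists_interface_of_ne (x := x) huw (by rw [hu]; exact Ne.symm hw)
      exact he (hJ e)
    · obtain ⟨e, -, he⟩ := exists_interface_of_ne (x := x) huw (by rw [hu]; exact hw)
      exact he (hJ e)
  refine Set.infinite_univ ((finite_of_expEnergy_pos hs hv h).subset fun w _ => ?_)
  simp [countEnergy, hall]

lemma forall_of_expEnergy_countEnergy_eq_one {i : Bool} {x : Config ℤ} {s : ℝ} (hs : 0 < s)
    (hv : ∀ u x y, 0 ≤ countEnergy i u x y) (h : expEnergy s (countEnergy i) x = 1) :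
    ∀ u, x u = !i := by
  by_contra hcon
  push Not at hcon
  obtain ⟨u, hu⟩ := hcon
  have hu : x u = i := bool_eq_of_ne hu (by cases i <;> simp)
  have h1 : 1 ≤ energy (countEnergy i) u.natAbs x := by
    refine le_trans ?_ (Finset.single_le_sum (fun w _ => hv w _ _)
      (Finset.mem_Icc.2 ⟨by lia, by lia⟩ : u ∈ _))
    unfold countEnergy
    rw [if_pos hu]
    split_ifs <;> norm_num
  have h2 := expEnergy_le s (countEnergy i) u.natAbs x
  rw [h, Real.one_le_exp_iff] at h2
  nlinarith

lemma measurableSet_forall_eq (b : Bool) : MeasurableSet {x : Config ℤ | ∀ u, x u = b} := by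
  have : {x : Config ℤ | ∀ u, x u = b} = ⋂ u, {x | x u = b} := by ext; simp
  rw [this]
  exact MeasurableSet.iInter fun u => measurable_pi_apply u (measurableSet_singleton _)

/-- The disfavoured type, initially finite, is extinct at some time with probability close to
one. -/
lemma HasDynkin.exists_extinct (h : HasDynkin α γ P X ℱ) (hα : 0 ≤ α) (hγ : 0 ≤ γ) {i : Bool}
    (hi : if i then γ ≤ α else α ≤ γ) (h0 : ∀ᵐ ω ∂P, FinitelyMany i (X 0 ω)) {ε : ℝ}
    (hε : 0 < ε) : ∃ t, 1 - 2 * ε ≤ P.real {ω | ∀ u, X t ω u = !i} := by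
  have hv := fun s hs => isLyapunov_countEnergy hα hγ hi (s := s) hs
  obtain ⟨s, hs, hsA⟩ := h.exists_expEnergy_ge hα hγ hv (A := Set.univ) MeasurableSet.univ
    (by rw [Measure.restrict_univ]; exact h0.mono fun ω hω => hω.energy_countEnergy_le) hε
  have hl := hv s hs
  obtain ⟨t, ht⟩ : ∃ t, ∫ ω in Set.univ, expEnergy s (countEnergy i) (X t ω)
      * hasInterface Set.univ (X t ω) ∂P ≤ ε := by
    by_contra! hcon
    obtain ⟨T, hT⟩ := exists_nat_gt (1 / (s ^ 2 / 4) / ε)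
    have h1 := h.occupation_le hα hγ hl T (A := Set.univ) MeasurableSet.univ
    have h2 : ∫ r in (0 : ℝ)..(T : ℝ≥0), ε ≤ ∫ r in (0 : ℝ)..(T : ℝ≥0),
        ∫ ω in Set.univ, expEnergy s (countEnergy i) (X r.toNNReal ω)
          * hasInterface Set.univ (X r.toNNReal ω) ∂P :=
      intervalIntegral.integral_mono_on (by simp) (by simp)
        (h.intervalIntegrable_occupation hs.le hl.nonneg _ _ _ _) fun r _ => (hcon _).le
    rw [intervalIntegral.integral_const, smul_eq_mul, sub_zero, NNReal.coe_natCast] at h2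
    rw [NNReal.coe_natCast] at h1
    rw [div_lt_iff₀ hε] at hT
    linarith
  refine ⟨t, ?_⟩
  set S : Set Ω := {ω | ∀ u, X t ω u = !i} with hSdef
  have hS : MeasurableSet S := h.measurable t (measurableSet_forall_eq !i)
  have h1 := hsA t
  have h2 : ∫ ω in Set.univ, (expEnergy s (countEnergy i) (X t ω)
      - expEnergy s (countEnergy i) (X t ω) * hasInterface Set.univ (X t ω)) ∂P
      ≤ ∫ ω in Set.univ, S.indicator 1 ω ∂P := by
    refine integral_mono ((h.integrable_expEnergy hs.le hl.nonneg _ _).sub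
      (h.integrable_expEnergy_mul hs.le hl.nonneg _ _ _))
      ((integrable_const (1 : ℝ)).indicator hS) fun ω => ?_
    have e0 := expEnergy_nonneg s (countEnergy i) (X t ω)
    have e1 := expEnergy_le_one hs.le hl.nonneg (X t ω)
    by_cases hx : ω ∈ S
    · rw [Set.indicator_of_mem hx, Pi.one_apply]
      have := mul_nonneg e0 (hasInterface_nonneg Set.univ (X t ω))
      linarith
    · rw [Set.indicator_of_notMem hx]
      unfold hasInterface
      split_ifs with hJ
      · simp
      · rw [mul_zero, sub_zero]
        refine le_of_not_gt fun hpos => hx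
          (forall_of_expEnergy_countEnergy_pos hs hl.nonneg hpos fun e => ?_)
        by_contra he
        exact hJ ⟨e, trivial, he⟩
  rw [integral_sub (h.integrable_expEnergy hs.le hl.nonneg _ _)
    (h.integrable_expEnergy_mul hs.le hl.nonneg _ _ _), integral_indicator_one hS,
    Measure.restrict_univ] at h2
  rw [Measure.restrict_univ, probReal_univ] at h1
  rw [Measure.restrict_univ] at ht
  linarith

/-- The configuration without the disfavoured type is absorbing. -/
lemma HasDynkin.absorbing (h : HasDynkin α γ P X ℱ) (hα : 0 ≤ α) (hγ : 0 ≤ γ) {i : Bool}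
    (hi : if i then γ ≤ α else α ≤ γ) {τ t : ℝ≥0} (hτt : τ ≤ t) :
    ∀ᵐ ω ∂P, (∀ u, X τ ω u = !i) → ∀ u, X t ω u = !i := by
  have hl := isLyapunov_countEnergy hα hγ hi one_pos
  have hA : MeasurableSet[ℱ τ] {ω | ∀ u, X τ ω u = !i} :=
    h.adapted τ (measurableSet_forall_eq !i)
  have hA' := ℱ.le τ _ hA
  have h1 := h.expEnergy_mono hα hγ hl hτt hA
  rw [setIntegral_congr_fun hA' fun ω hω => expEnergy_countEnergy_of_forall hω 1] at h1
  have hi1 := h.integrable_expEnergy hl.pos.le hl.nonneg t {ω | ∀ u, X τ ω u = !i}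
  have hi2 := (integrable_const (μ := P.restrict {ω | ∀ u, X τ ω u = !i}) (1 : ℝ)).sub hi1
  have hnn : ∀ ω, 0 ≤ 1 - expEnergy 1 (countEnergy i) (X t ω) := fun ω =>
    sub_nonneg.2 (expEnergy_le_one hl.pos.le hl.nonneg _)
  have h2 : ∫ ω in {ω | ∀ u, X τ ω u = !i}, (1 - expEnergy 1 (countEnergy i) (X t ω)) ∂P = 0 := by
    refine le_antisymm ?_ (integral_nonneg hnn)
    rw [integral_sub (integrable_const _) hi1]
    linarith
  have h3 := (integral_eq_zero_iff_of_nonneg hnn hi2).1 h2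
  filter_upwards [(ae_restrict_iff' hA').1 h3] with ω hω hx
  have h4 : 1 - expEnergy 1 (countEnergy i) (X t ω) = 0 := hω hx
  exact forall_of_expEnergy_countEnergy_eq_one one_pos hl.nonneg (by linarith)

lemma HasDynkin.diesOut (h : HasDynkin α γ P X ℱ) (hα : 0 ≤ α) (hγ : 0 ≤ γ)
    (hrc : ∀ (ω : Ω) (t : ℝ≥0), ContinuousWithinAt (fun s => X s ω) (Set.Ici t) t) {i : Bool}
    (hi : if i then γ ≤ α else α ≤ γ) (h0 : ∀ᵐ ω ∂P, FinitelyMany i (X 0 ω)) :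
    DiesOut P X i := by
  intro u
  obtain ⟨D, hDc, hDd⟩ := TopologicalSpace.exists_countable_dense ℝ≥0
  -- Absorption at the times of a countable dense set extends to all times by right-continuity.
  have habs : ∀ τ, ∀ᵐ ω ∂P, (∀ u, X τ ω u = !i) → Tendsto (fun t => X t ω u) atTop (𝓝 (!i)) := by
    intro τ
    have hD : ∀ᵐ ω ∂P, ∀ q ∈ D, τ ≤ q → (∀ u, X τ ω u = !i) → ∀ u, X q ω u = !i := by
      refine (ae_ball_iff hDc).2 fun q _ => ?_
      by_cases hq : τ ≤ q
      · filter_upwards [h.absorbing hα hγ hi hq] with ω hω _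
        exact hω
      · exact ae_of_all _ fun ω hq' => absurd hq' hq
    filter_upwards [hD] with ω hω hx
    refine tendsto_const_nhds.congr' ?_
    filter_upwards [eventually_ge_atTop τ] with t ht
    have hc : Tendsto (fun s => X s ω u) (𝓝[>] t) (𝓝 (X t ω u)) :=
      ((continuous_apply u).continuousAt.tendsto.comp (hrc ω t).tendsto).mono_left
        (nhdsWithin_mono t Set.Ioi_subset_Ici_self)
    rw [nhds_discrete, tendsto_pure] at hc
    obtain ⟨b, hb, hbs⟩ := mem_nhdsGT_iff_exists_Ioo_subset.1 hc
    obtain ⟨q, hqD, hq⟩ := hDd.exists_between hb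
    have h1 : X q ω u = X t ω u := hbs hq
    rw [← h1, hω q hqD (ht.trans hq.1.le) hx u]
  rw [ae_iff]
  refine le_antisymm (ENNReal.le_of_forall_pos_le_add fun ε hε _ => ?_) bot_le
  obtain ⟨t, ht⟩ := h.exists_extinct hα hγ hi h0 (ε := (ε : ℝ) / 2) (by positivity)
  set S : Set Ω := {ω | ∀ u, X t ω u = !i}
  have hS : MeasurableSet S := h.measurable t (measurableSet_forall_eq !i)
  have h1 : P {ω | ¬Tendsto (fun t => X t ω u) atTop (𝓝 (!i))} ≤ P Sᶜ := by
    refine measure_mono_ae ?_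
    filter_upwards [habs t] with ω hω hx hS
    exact hx (hω hS)
  refine h1.trans ?_
  rw [zero_add, ← ENNReal.ofReal_coe_nnreal, ← ofReal_measureReal]
  refine ENNReal.ofReal_le_ofReal ?_
  rw [probReal_compl_eq_one_sub hS]
  linarith

end

end VMBC

theorem theorem3p5 {Ω : Type*} [MeasurableSpace Ω] (P : Measure Ω) [IsProbabilityMeasure P]
    (α γ : ℝ) (hα : 0 ≤ α) (hγ : 0 ≤ γ) (X : ℝ≥0 → Ω → VMBC.Config ℤ)
    (hX : VMBC.IsCVMBC VMBC.nnKernel α γ P X)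
    (h0 : ∀ᵐ ω ∂P, VMBC.FinitelyMany true (X 0 ω) ∨ VMBC.FinitelyMany false (X 0 ω)) :
    VMBC.Clusters P X ∧
    (γ ≤ α → (∀ᵐ ω ∂P, VMBC.FinitelyMany true (X 0 ω)) → VMBC.DiesOut P X true) ∧
    (α ≤ γ → (∀ᵐ ω ∂P, VMBC.FinitelyMany false (X 0 ω)) → VMBC.DiesOut P X false) := by
  obtain ⟨ℱ, h⟩ := hX.exists_hasDynkin
  exact ⟨h.clusters_of_finitelyMany hα hγ h0,
    fun hi h1 => h.diesOut hα hγ hX.right_continuous (by simpa using hi) h1,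
    fun hi h1 => h.diesOut hα hγ hX.right_continuous (by simpa using hi) h1⟩
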